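/- Let $U,V:\mathbb R\to\mathbb R$ be $C^2$ functions with $U''(x)>0$ for all $x\in\mathbb R$ and $\lim_{x\to\pm\infty}U(x)/|x|=+\infty$. Let $\mathcal{QC}=(s_n)_{n\in\mathbb Z}$ be a non-decreasing sequence of real numbers. Its segments are the finite sequences $(s_n,\dots,s_{n+p})$; two segments $(s_n,\dots,s_{n+p})$ and $(s_q,\dots,s_{q+p})$ are equivalent if for some $\tau\in\mathbb R$ one has $s_{q+i}=s_{n+i}+\tau$ for $i=0,\dots,p$. Assume that $\mathcal{QC}$ is a quasicrystal, that is: - (finite local complexity) for every $M>0$ there are only finitely many equivalence classes of segments of diameter smaller than $M$; - (repetitivity) for every segment $S$ there is $R>0$ such that every ball of radius $R$ in $\mathbb R$ contains a segment equivalent to $S$; - (uniform pattern distribution) for every segment $S$, writing $n(S,x,M)$ for the number of segments equivalent to $S$ contained in $[x,x+M]$, the quotient $n(S,x,M)/M$ converges as $M\to+\infty$, uniformly in $x\in\mathbb R$, to a limit $\nu(S)$ that does not depend on $x$. Assume that $V$ is a short range potential associated with $\mathcal{QC}$: there is $R>0$ such that $V(x)=V(y)$ whenever $(\mathcal{QC}\cap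 B_R(x))-x=(\mathcal{QC}\cap B_R(y))-y$, where $B_R(z)$ is the ball of centre $z$ and radius $R$ and $\mathcal{QC}$ is regarded as a subset of $\mathbb R$. A configuration is a non-decreasing sequence $(\theta_n)_{n\in\mathbb Z}$ of real numbers. It is minimal if for all $i\in\mathbb Z$, $p\ge 0$ and every non-decreasing segment $(\theta'_i,\dots,\theta'_{i+p})$ with $\theta'_i=\theta_i$ and $\theta'_{i+p}=\theta_{i+p}$, $$\sum_{j=0}^{p-1}\bigl(U(\theta_{i+j}-\theta_{i+j+1})+V(\theta_{i+j})\bigr)\le\sum_{j=0}^{p-1}\bigl(U(\theta'_{i+j}-\theta'_{i+j+1})+V(\theta'_{i+j})\bigr).$$ It has rotation number $\rho$ if $\theta_n/n\to\rho$ both as $n\to+\infty$ and as $n\to-\infty$. Then: (i) every minimal configuration has a rotation number; (ii) the rotation number is a continuous function on the set of minimal configurations, equipped with the topology induced by the product topology of $\mathbb R^{\mathbb Z}$; (iii) for every $\rho\ge0$ there is a minimal configuration with rotation number $\rho$. -/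

import Mathlib

open Filter Topology

namespace FrenkelKontorova

/-! ### The substrate -/

/-- The segments `(s n, …, s (n + p))` and `(s q, …, s (q + p))` of the chain `s` are equivalent:
the second is a translate of the first. -/
def SegmentEquiv (s : ℤ → ℝ) (n q : ℤ) (p : ℕ) : Prop :=
  ∃ τ : ℝ, ∀ i : ℕ, i ≤ p → s (q + i) = s (n + i) + τ

/-- For every `M > 0`, there are only finitely many equivalence classes of segments of diameter
smaller than `M` (the finite set `F` of pairs `(q, p)` lists representatives
`(s q, …, s (q + p))` of these classes). -/
def FiniteLocalComplexity (s : ℤ → ℝ) : Prop :=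
  ∀ M : ℝ, 0 < M → ∃ F : Set (ℤ × ℕ), F.Finite ∧
    ∀ (n : ℤ) (p : ℕ), s (n + p) - s n < M → ∃ q : ℤ, (q, p) ∈ F ∧ SegmentEquiv s q n p

/-- For every segment there is `R > 0` such that every ball of radius `R` contains a segment
equivalent to it. -/
def Repetitive (s : ℤ → ℝ) : Prop :=
  ∀ (n : ℤ) (p : ℕ), ∃ R : ℝ, 0 < R ∧ ∀ x : ℝ, ∃ q : ℤ,
    SegmentEquiv s n q p ∧ ∀ i : ℕ, i ≤ p → s (q + i) ∈ Metric.ball x R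

/-- The number of segments equivalent to `(s n, …, s (n + p))` in the interval `[x, x + M]`. -/
noncomputable def segmentCount (s : ℤ → ℝ) (n : ℤ) (p : ℕ) (x M : ℝ) : ℕ :=
  Set.ncard {q : ℤ | SegmentEquiv s n q p ∧ ∀ i : ℕ, i ≤ p → s (q + i) ∈ Set.Icc x (x + M)}

/-- Every segment has a frequency, uniformly with respect to the position of the window. -/
def UniformPatternDistribution (s : ℤ → ℝ) : Prop :=
  ∀ (n : ℤ) (p : ℕ), ∃ ν : ℝ,
    TendstoUniformly (fun (M : ℝ) (x : ℝ) => (segmentCount s n p x M : ℝ) / M)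
      (fun _ : ℝ => ν) atTop

/-- A one-dimensional quasicrystal. -/
structure IsQuasicrystal (s : ℤ → ℝ) : Prop where
  monotone : Monotone s
  finiteLocalComplexity : FiniteLocalComplexity s
  repetitive : Repetitive s
  uniformPatternDistribution : UniformPatternDistribution s

/-- `V` has range `R` with respect to the chain `s`: the value `V x` depends only on the set of
atoms of the chain in the ball of radius `R` centred at `x`, seen from `x`. -/
def HasRange (s : ℤ → ℝ) (V : ℝ → ℝ) (R : ℝ) : Prop :=
  ∀ x y : ℝ,
    (fun t : ℝ => t - x) '' (Set.range s ∩ Metric.ball x R) =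
      (fun t : ℝ => t - y) '' (Set.range s ∩ Metric.ball y R) →
    V x = V y

/-- A short range potential associated with the chain `s`. -/
def IsShortRangePotential (s : ℤ → ℝ) (V : ℝ → ℝ) : Prop :=
  ∃ R : ℝ, 0 < R ∧ HasRange s V R

/-! ### The layer -/

/-- The energy of the segment `(θ i, …, θ (i + p))`. -/
noncomputable def segmentEnergy (U V : ℝ → ℝ) (θ : ℤ → ℝ) (i : ℤ) (p : ℕ) : ℝ :=
  ∑ j ∈ Finset.range p, (U (θ (i + j) - θ (i + j + 1)) + V (θ (i + j)))

/-- Configurations are non-decreasing bi-infinite sequences. The segment `(θ i, …, θ (i + p))` is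
minimal if its energy is at most that of every segment (of a configuration) with the same
endpoints. -/
def IsMinimalSegment (U V : ℝ → ℝ) (θ : ℤ → ℝ) (i : ℤ) (p : ℕ) : Prop :=
  ∀ θ' : ℤ → ℝ, Monotone θ' → θ' i = θ i → θ' (i + p) = θ (i + p) →
    segmentEnergy U V θ i p ≤ segmentEnergy U V θ' i p

/-- The set of minimal configurations: those all of whose segments are minimal. As a subset of
`ℤ → ℝ` it carries the product topology. -/
def minimalConfigurations (U V : ℝ → ℝ) : Set (ℤ → ℝ) :=
  {θ | Monotone θ ∧ ∀ (i : ℤ) (p : ℕ), IsMinimalSegment U V θ i p}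

/-- `θ n / n` converges to `ρ` both as `n → +∞` and as `n → -∞`. -/
def HasRotationNumber (θ : ℤ → ℝ) (ρ : ℝ) : Prop :=
  Tendsto (fun n : ℤ => θ n / (n : ℝ)) atTop (𝓝 ρ) ∧
    Tendsto (fun n : ℤ => θ n / (n : ℝ)) atBot (𝓝 ρ)

end FrenkelKontorova

/-!
The proof rests on a comparison of the numbers of atoms of a minimal configuration in two disjoint
windows where the potential is the same: they differ by at most two
(`IsMinimalPath.card_le_of_windows`, `IsMinimalPath.atomCount_sub_le`). Suppose that a piece `g` of
the configuration inside the first window, brought over to the second one, has one step more than a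
piece `f` that starts before the second window and ends after it. Then `f` starts below `g` and
ends above it, both with the given indexing and with the indices of `g` shifted by one. Switching between `f` and `g` at
these two crossings moves one atom from the first window to the second; the part of the
configuration between the windows is only reindexed, so that it keeps its energy. By convexity of
`U` the total energy does not increase. It cannot decrease strictly, and if it is unchanged then
there are two minimal paths that coincide up to some time and then separate, which is impossible
(`IsMinimalPath.not_lt_of_agree`). As configurations are only required to be non-decreasing, a single
atom need not satisfy an Euler-Lagrange equation; the argument translates whole blocks of coinciding
atoms instead.

By finite local complexity and repetitivity, every window of a given length recurs, with the same
potential, in every interval of some larger length (`IsQuasicrystal.isUniformlyRecurrent`). Hence a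
crowded piece somewhere makes the configuration crowded everywhere, and a long piece somewhere makes
it sparse everywhere. In particular minimal configurations are bounded, with rotation number `0`, or
unbounded on both sides with bounded steps and locally bounded numbers of atoms.

In the second case, consider blocks of `K` consecutive steps of the chain `s`. Equivalent blocks,
with their surroundings, contain the same number of atoms up to `4`, and every class of blocks has a
uniform frequency; as there are finitely many classes, the mean number of atoms per unit length is
the same in all long pieces up to `O(1 / K)` (`IsQuasicrystal.exists_density`). The length needed for
a given precision is uniform in the configuration, and the statement holds for finite minimal paths.
This gives at once the rotation number, as the inverse of the density, its continuity, and
configurations with prescribed rotation number `ρ > 0`, as limits of long minimal paths of mean step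
`ρ`. At bounded configurations continuity follows from recurrence alone, and constant configurations
have rotation number `0`.
-/

namespace FrenkelKontorova

variable {U V : ℝ → ℝ} {s : ℤ → ℝ}

/-! ### Finite paths and their energy -/

/-- The energy of the finite path `(f 0, …, f p)`. Finite pieces of configurations are handled as
functions on `ℕ` of which only the first `p + 1` values matter. -/
noncomputable def pathEnergy (U V : ℝ → ℝ) (f : ℕ → ℝ) (p : ℕ) : ℝ :=
  ∑ t ∈ Finset.range p, (U (f t - f (t + 1)) + V (f t))

/-- The path `(f 0, …, f p)` is non-decreasing and has the least energy among the non-decreasing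
paths with the same length and the same endpoints. -/
def IsMinimalPath (U V : ℝ → ℝ) (f : ℕ → ℝ) (p : ℕ) : Prop :=
  (∀ t < p, f t ≤ f (t + 1)) ∧ ∀ g : ℕ → ℝ, (∀ t < p, g t ≤ g (t + 1)) → g 0 = f 0 → g p = f p →
    pathEnergy U V f p ≤ pathEnergy U V g p

/-- Follow `f` for `p` steps, then `g`. Meant for `f p = g 0`. -/
def concatPath (f : ℕ → ℝ) (p : ℕ) (g : ℕ → ℝ) : ℕ → ℝ :=
  fun t => if t ≤ p then f t else g (t - p)

theorem le_of_steps {f : ℕ → ℝ} {N : ℕ} (hf : ∀ t < N, f t ≤ f (t + 1)) {i j : ℕ} (hij : i ≤ j)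
    (hj : j ≤ N) : f i ≤ f j := by
  induction j, hij using Nat.le_induction with
  | base => exact le_rfl
  | succ j hij ih => exact (ih (by omega)).trans (hf j (by omega))

theorem pathEnergy_congr {f g : ℕ → ℝ} {p : ℕ} (h : ∀ t ≤ p, f t = g t) :
    pathEnergy U V f p = pathEnergy U V g p := by
  refine Finset.sum_congr rfl fun t ht => ?_
  have := Finset.mem_range.1 ht
  rw [h t (by omega), h (t + 1) (by omega)]

theorem pathEnergy_add (f : ℕ → ℝ) (p q : ℕ) :
    pathEnergy U V f (p + q) = pathEnergy U V f p + pathEnergy U V (fun t => f (p + t)) q := by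
  simp only [pathEnergy, Finset.sum_range_add, add_assoc]

theorem concatPath_left (f g : ℕ → ℝ) {p t : ℕ} (ht : t ≤ p) : concatPath f p g t = f t :=
  if_pos ht

theorem concatPath_right {f g : ℕ → ℝ} {p : ℕ} (h : f p = g 0) (t : ℕ) :
    concatPath f p g (p + t) = g t := by
  rcases Nat.eq_zero_or_pos t with rfl | ht
  · simp [concatPath, h]
  · simp [concatPath, ht.ne']

theorem pathEnergy_concatPath {f g : ℕ → ℝ} {p : ℕ} (h : f p = g 0) (q : ℕ) :
    pathEnergy U V (concatPath f p g) (p + q) = pathEnergy U V f p + pathEnergy U V g q := by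
  rw [pathEnergy_add]
  congr 1
  · exact pathEnergy_congr fun t ht => concatPath_left f g ht
  · exact pathEnergy_congr fun t _ => concatPath_right h t

theorem concatPath_steps {f g : ℕ → ℝ} {p q : ℕ} (h : f p = g 0) (hf : ∀ t < p, f t ≤ f (t + 1))
    (hg : ∀ t < q, g t ≤ g (t + 1)) :
    ∀ t < p + q, concatPath f p g t ≤ concatPath f p g (t + 1) := by
  intro t ht
  rcases lt_or_ge t p with htp | htp
  · rw [concatPath_left f g htp.le, concatPath_left f g htp]
    exact hf t htp
  · obtain ⟨u, rfl⟩ := Nat.exists_eq_add_of_le htp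
    rw [concatPath_right h, add_assoc, concatPath_right h]
    exact hg u (by omega)

/-- In a minimal path, an initial and a final piece can be replaced by paths with the same endpoints
and other lengths, as long as the total length is preserved: the middle piece is merely reindexed,
at no cost. -/
theorem IsMinimalPath.exchange {f : ℕ → ℝ} {p h q p' q' : ℕ}
    (hf : IsMinimalPath U V f (p + h + q)) (hpq : p' + q' = p + q) {α β : ℕ → ℝ}
    (hα : ∀ t < p', α t ≤ α (t + 1)) (hβ : ∀ t < q', β t ≤ β (t + 1))
    (hα0 : α 0 = f 0) (hαp : α p' = f p) (hβ0 : β 0 = f (p + h)) (hβq : β q' = f (p + h + q)) :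
    pathEnergy U V f p + pathEnergy U V (fun t => f (p + h + t)) q ≤
      pathEnergy U V α p' + pathEnergy U V β q' := by
  have h1 : α p' = (fun t => f (p + t)) 0 := by simpa using hαp
  have h2 : concatPath α p' (fun t => f (p + t)) (p' + h) = β 0 := by
    rw [concatPath_right h1, hβ0]
  have hlen : p + h + q = p' + h + q' := by omega
  have key := hf.2 (concatPath (concatPath α p' fun t => f (p + t)) (p' + h) β)
    (by
      rw [hlen]
      exact concatPath_steps h2 (concatPath_steps h1 hα fun t ht => hf.1 (p + t) (by omega)) hβ)
    (by rw [concatPath_left _ _ (Nat.zero_le _), concatPath_left _ _ (Nat.zero_le _), hα0])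
    (by rw [hlen, concatPath_right h2, hβq, hlen])
  rw [pathEnergy_add, pathEnergy_add, hlen, pathEnergy_concatPath h2, pathEnergy_concatPath h1]
    at key
  linarith

theorem IsMinimalPath.sub {f : ℕ → ℝ} {N : ℕ} (hf : IsMinimalPath U V f N) {i p : ℕ}
    (hip : i + p ≤ N) : IsMinimalPath U V (fun t => f (i + t)) p := by
  have hpre : ∀ {f : ℕ → ℝ} {p q : ℕ}, IsMinimalPath U V f (p + q) → IsMinimalPath U V f p := by
    intro f p q hf
    refine ⟨fun t ht => hf.1 t (by omega), fun g hg h0 hp => ?_⟩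
    have := IsMinimalPath.exchange (h := 0) (p := p) (q := q) hf rfl hg
      (β := fun t => f (p + t)) (fun t ht => hf.1 (p + t) (by omega)) h0 hp rfl rfl
    simpa using this
  obtain ⟨q, rfl⟩ := Nat.exists_eq_add_of_le hip
  have hf' : IsMinimalPath U V f (i + p) := hpre hf
  refine ⟨fun t ht => hf'.1 (i + t) (by omega), fun g hg h0 hp => ?_⟩
  have := IsMinimalPath.exchange (h := 0) (p := i) (q := p) hf' rfl (α := f) (β := g)
    (fun t ht => hf'.1 t (by omega)) hg rfl rfl h0 hp
  simpa using this

/-! ### Uniqueness of the continuation of a minimal path -/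

theorem hasDerivAt_pathEnergy (hU : Differentiable ℝ U) (hV : Differentiable ℝ V) (f b : ℕ → ℝ)
    (p : ℕ) : HasDerivAt (fun ε : ℝ => pathEnergy U V (fun t => f t + ε * b t) p)
      (∑ t ∈ Finset.range p, (deriv U (f t - f (t + 1)) * (b t - b (t + 1)) + deriv V (f t) * b t))
      0 := by
  refine HasDerivAt.fun_sum fun t _ => HasDerivAt.add ?_ ?_
  · have h1 : HasDerivAt (fun ε : ℝ => f t + ε * b t - (f (t + 1) + ε * b (t + 1)))
        (b t - b (t + 1)) 0 := by
      have h := ((hasDerivAt_id (0 : ℝ)).mul_const (b t - b (t + 1))).const_add (f t - f (t + 1))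
      simp only [one_mul] at h
      exact h.congr_of_eventuallyEq (.of_forall fun ε => by simp only [id]; ring)
    have h2 : HasDerivAt U (deriv U (f t - f (t + 1)))
        (f t + 0 * b t - (f (t + 1) + 0 * b (t + 1))) := by
      simpa using (hU _).hasDerivAt
    exact h2.comp (0 : ℝ) h1
  · have h1 : HasDerivAt (fun ε : ℝ => f t + ε * b t) (b t) 0 := by
      simpa using ((hasDerivAt_id (0 : ℝ)).mul_const (b t)).const_add (f t)
    have h2 : HasDerivAt V (deriv V (f t)) (f t + 0 * b t) := by
      simpa using (hV _).hasDerivAt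
    exact h2.comp (0 : ℝ) h1

/-- Two non-constant minimal paths that agree up to time `k` cannot separate at time `k + 1`. The
last block of coinciding atoms is translated by `ε`: for the upper path `f` both signs of `ε` are
allowed, so the derivative of the energy vanishes; for the lower path it is then positive, so that
moving the block to the left decreases the energy. -/
theorem IsMinimalPath.not_lt_of_agree (hU : Differentiable ℝ U) (hU' : StrictMono (deriv U))
    (hV : Differentiable ℝ V) {f g : ℕ → ℝ} {k : ℕ} (hf : IsMinimalPath U V f (k + 1))
    (hg : IsMinimalPath U V g (k + 1)) (hfg : ∀ t ≤ k, g t = f t) (h0 : f 0 < f k) :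
    ¬ g (k + 1) < f (k + 1) := by
  intro hlt
  set b : ℕ → ℝ := fun t => if t ≤ k ∧ f t = f k then 1 else 0 with hb
  have hb0 : b 0 = 0 := by simp [hb, h0.ne]
  have hbk : b k = 1 := by simp [hb]
  have hbk1 : b (k + 1) = 0 := by simp [hb]
  have hgk : f k ≤ g (k + 1) := by
    rw [← hfg k le_rfl]; exact hg.1 k (by omega)
  -- before the block, the atoms stay below it for small `ε`
  have hsmall : ∀ᶠ ε in 𝓝 (0 : ℝ), ∀ t ∈ Finset.range k, f t + ε * b t ≤
      f (t + 1) + ε * b (t + 1) := by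
    rw [Filter.eventually_all_finset]
    intro t ht
    have htk := Finset.mem_range.1 ht
    rcases eq_or_lt_of_le (le_of_steps hf.1 (Nat.le_succ t) (by omega)) with heq | hlt'
    · refine .of_forall fun ε => ?_
      have : b t = b (t + 1) := by
        simp only [hb, heq, show t ≤ k by omega, show t + 1 ≤ k by omega]
      rw [heq, this]
    · have h1 : Tendsto (fun ε : ℝ => f t + ε * b t) (𝓝 0) (𝓝 (f t)) := by
        have : Continuous fun ε : ℝ => f t + ε * b t := by fun_prop
        simpa using this.tendsto 0
      have h2 : Tendsto (fun ε : ℝ => f (t + 1) + ε * b (t + 1)) (𝓝 0) (𝓝 (f (t + 1))) := by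
        have : Continuous fun ε : ℝ => f (t + 1) + ε * b (t + 1) := by fun_prop
        simpa using this.tendsto 0
      exact (h1.eventually_lt h2 hlt').mono fun ε h => h.le
  have hsmall' : ∀ᶠ ε in 𝓝 (0 : ℝ), f k + ε ≤ f (k + 1) := by
    have h1 : Tendsto (fun ε : ℝ => f k + ε) (𝓝 0) (𝓝 (f k)) := by
      have : Continuous fun ε : ℝ => f k + ε := by fun_prop
      simpa using this.tendsto 0
    exact (h1.eventually_lt_const (hgk.trans_lt hlt)).mono fun ε h => h.le
  have hmin : ∀ᶠ ε in 𝓝 (0 : ℝ), pathEnergy U V (fun t => f t + 0 * b t) (k + 1) ≤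
      pathEnergy U V (fun t => f t + ε * b t) (k + 1) := by
    filter_upwards [hsmall, hsmall'] with ε h1 h2
    simp only [zero_mul, add_zero]
    refine hf.2 _ (fun t ht => ?_) (by simp [hb0]) (by simp [hbk1])
    rcases Nat.lt_succ_iff_lt_or_eq.1 ht with h | rfl
    · exact h1 t (Finset.mem_range.2 h)
    · simpa [hbk, hbk1] using h2
  have hmin' : ∀ᶠ ε in 𝓝[<] (0 : ℝ), pathEnergy U V (fun t => g t + 0 * b t) (k + 1) ≤
      pathEnergy U V (fun t => g t + ε * b t) (k + 1) := by
    filter_upwards [hsmall.filter_mono nhdsWithin_le_nhds, self_mem_nhdsWithin] with ε h1 h2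
    simp only [zero_mul, add_zero]
    refine hg.2 _ (fun t ht => ?_) (by simp [hb0]) (by simp [hbk1])
    rcases Nat.lt_succ_iff_lt_or_eq.1 ht with h | rfl
    · rw [hfg t h.le, hfg (t + 1) h]
      exact h1 t (Finset.mem_range.2 h)
    · have : ε < 0 := h2
      simp only [hbk, hbk1, hfg t le_rfl]
      linarith
  have hDf := hasDerivAt_pathEnergy hU hV f b (k + 1)
  have hDg := hasDerivAt_pathEnergy hU hV g b (k + 1)
  have hzero := IsLocalMin.hasDerivAt_eq_zero (f := fun ε : ℝ => pathEnergy U V (fun t => f t + ε * b t) (k + 1))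
    hmin hDf
  have hcmp : ∑ t ∈ Finset.range (k + 1), (deriv U (f t - f (t + 1)) * (b t - b (t + 1)) +
      deriv V (f t) * b t) < ∑ t ∈ Finset.range (k + 1),
      (deriv U (g t - g (t + 1)) * (b t - b (t + 1)) + deriv V (g t) * b t) := by
    rw [Finset.sum_range_succ, Finset.sum_range_succ]
    have : ∑ t ∈ Finset.range k, (deriv U (f t - f (t + 1)) * (b t - b (t + 1)) +
      deriv V (f t) * b t) = ∑ t ∈ Finset.range k,
      (deriv U (g t - g (t + 1)) * (b t - b (t + 1)) + deriv V (g t) * b t) := by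
      refine Finset.sum_congr rfl fun t ht => ?_
      have := Finset.mem_range.1 ht
      rw [hfg t (by omega), hfg (t + 1) (by omega)]
    rw [this, hbk, hbk1, hfg k le_rfl]
    have := hU' (show f k - f (k + 1) < f k - g (k + 1) by linarith)
    linarith
  rw [hzero] at hcmp
  have hneg := (hasDerivAt_iff_tendsto_slope.1 hDg).mono_left
    (nhdsWithin_mono (0 : ℝ) (fun x (hx : x < 0) => hx.ne))
  have hpos := hneg.eventually_const_lt hcmp
  have hfalse : ∀ᶠ ε in 𝓝[<] (0 : ℝ), False := by
    filter_upwards [hpos, hmin', self_mem_nhdsWithin] with ε h1 h2 h3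
    rw [slope_def_field] at h1
    have : ε < 0 := h3
    have := div_nonpos_of_nonneg_of_nonpos (sub_nonneg.2 h2) (show ε - 0 ≤ 0 by linarith)
    linarith
  simpa using hfalse.exists

/-! ### The crossing argument -/

theorem swap_lt (hU : StrictConvexOn ℝ Set.univ U) {a b c d : ℝ} (hab : a < b) (hcd : c < d) :
    U (a - c) + U (b - d) < U (a - d) + U (b - c) := by
  have hD : 0 < (b - a) + (d - c) := by linarith
  obtain ⟨v, hv⟩ : ∃ v, v = (d - c) / ((b - a) + (d - c)) := ⟨_, rfl⟩
  obtain ⟨w, hw⟩ : ∃ w, w = (b - a) / ((b - a) + (d - c)) := ⟨_, rfl⟩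
  have hv0 : 0 < v := hv ▸ div_pos (by linarith) hD
  have hw0 : 0 < w := hw ▸ div_pos (by linarith) hD
  have hvw : v + w = 1 := by
    rw [hv, hw, ← add_div, add_comm]; exact div_self hD.ne'
  have hvD : v * ((b - a) + (d - c)) = d - c := by rw [hv]; exact div_mul_cancel₀ _ hD.ne'
  have hne : a - d ≠ b - c := by intro h; linarith
  have h1 := hU.2 (Set.mem_univ (a - d)) (Set.mem_univ (b - c)) hne hw0 hv0 (by linarith)
  have h2 := hU.2 (Set.mem_univ (a - d)) (Set.mem_univ (b - c)) hne hv0 hw0 hvw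
  simp only [smul_eq_mul] at h1 h2
  have e1 : w * (a - d) + v * (b - c) = a - c := by
    rw [show w = 1 - v by linarith]; linarith
  have e2 : v * (a - d) + w * (b - c) = b - d := by
    rw [show w = 1 - v by linarith]; linarith
  rw [e1] at h1
  rw [e2] at h2
  have e3 : w * U (a - d) + v * U (b - c) + (v * U (a - d) + w * U (b - c)) =
      U (a - d) + U (b - c) := by
    rw [show w = 1 - v by linarith]; ring
  linarith

/-- If the step from `b` to `c` is nested in the step from `a` to `d`, exchanging the endpoints of the
two steps does not increase the interaction energy. -/
theorem swap_le (hU : StrictConvexOn ℝ Set.univ U) {a b c d : ℝ} (hab : a ≤ b) (hcd : c ≤ d) :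
    U (a - c) + U (b - d) ≤ U (a - d) + U (b - c) := by
  rcases hab.eq_or_lt with rfl | hab
  · exact (add_comm _ _).le
  · rcases hcd.eq_or_lt with rfl | hcd
    · exact le_rfl
    · exact (swap_lt hU hab hcd).le

theorem pathEnergy_succ (f : ℕ → ℝ) (p : ℕ) :
    pathEnergy U V f (p + 1) = pathEnergy U V f p + (U (f p - f (p + 1)) + V (f p)) :=
  Finset.sum_range_succ _ _

/-- The crossing argument for two paths seen in the same window: `g` has one step more than `f` but
starts after `f` and ends before `f`. Switching from `f` to `g` at the first crossing of the two
paths, and back to `f` at the first crossing of `f` with `g` reindexed by one, transfers an atom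
from `g` to `f` without increasing the energy; so the two paths cannot be jointly minimal. -/
theorem false_of_crossing (hU : Differentiable ℝ U) (hU' : StrictMono (deriv U))
    (hV : Differentiable ℝ V) {f g : ℕ → ℝ} {P : ℕ} (hf : IsMinimalPath U V f P)
    (hg : ∀ t < P + 1, g t ≤ g (t + 1)) (h0 : f 0 < g 0) (hP : g (P + 1) < f P)
    (hmin : ∀ α β : ℕ → ℝ, (∀ t < P + 1, α t ≤ α (t + 1)) → (∀ t < P, β t ≤ β (t + 1)) →
      α 0 = f 0 → α (P + 1) = f P → β 0 = g 0 → β P = g (P + 1) →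
      pathEnergy U V f P + pathEnergy U V g (P + 1) ≤
        pathEnergy U V α (P + 1) + pathEnergy U V β P) : False := by
  classical
  have hconv : StrictConvexOn ℝ Set.univ U :=
    StrictMonoOn.strictConvexOn_of_deriv convex_univ hU.continuous.continuousOn
      (hU'.strictMonoOn _)
  have hex1 : ∃ t, t ≤ P ∧ g t < f t := ⟨P, le_rfl, (hg P (by omega)).trans_lt hP⟩
  have hex2 : ∃ t, t ≤ P ∧ g (t + 1) < f t := ⟨P, le_rfl, hP⟩
  obtain ⟨k, hk⟩ : ∃ k, Nat.find hex1 = k + 1 := by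
    refine Nat.exists_eq_succ_of_ne_zero fun h => ?_
    have := (Nat.find_spec hex1).2
    rw [h] at this
    exact lt_asymm this h0
  obtain ⟨hkP, hk2⟩ := Nat.find_spec hex1
  rw [hk] at hkP hk2
  have hk1 : f k ≤ g k := by
    by_contra h
    exact Nat.find_min hex1 (m := k) (by omega) ⟨by omega, not_le.1 h⟩
  have hkm : k + 1 ≤ Nat.find hex2 := by
    rw [← hk]
    refine Nat.find_min' hex1 ⟨(Nat.find_spec hex2).1, ?_⟩
    exact (hg _ (Nat.lt_succ_of_le (Nat.find_spec hex2).1)).trans_lt (Nat.find_spec hex2).2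
  obtain ⟨d, hd⟩ := Nat.exists_eq_add_of_le hkm
  obtain ⟨hmP, hm2⟩ := Nat.find_spec hex2
  have hm1 : f (k + d) ≤ g (k + d + 1) := by
    by_contra h
    exact Nat.find_min hex2 (m := k + d) (by omega) ⟨by omega, not_le.1 h⟩
  rw [hd, show k + 1 + d = k + d + 1 by omega] at hmP hm2
  clear hd hkm hk hex1 hex2
  have hfm := hf.1
  set α : ℕ → ℝ := fun t => if t ≤ k then f t else if t ≤ k + d + 1 then g t else f (t - 1) with hα
  set β : ℕ → ℝ := fun t => if t ≤ k then g t else if t ≤ k + d then f t else g (t + 1) with hβ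
  have hα1 : ∀ t ≤ k, α t = f t := fun t ht => if_pos ht
  have hα2 : ∀ t, k + 1 ≤ t → t ≤ k + d + 1 → α t = g t := fun t h1 h2 => by
    simp only [hα, show ¬ t ≤ k by omega, h2, if_true, if_false]
  have hα3 : ∀ t, k + d + 1 ≤ t → α (t + 1) = f t := fun t h1 => by
    simp only [hα, show ¬ t + 1 ≤ k by omega, show ¬ t + 1 ≤ k + d + 1 by omega, if_false,
      Nat.add_sub_cancel]
  have hβ1 : ∀ t ≤ k, β t = g t := fun t ht => if_pos ht
  have hβ2 : ∀ t, k + 1 ≤ t → t ≤ k + d → β t = f t := fun t h1 h2 => by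
    simp only [hβ, show ¬ t ≤ k by omega, h2, if_true, if_false]
  have hβ3 : ∀ t, k + d + 1 ≤ t → β t = g (t + 1) := fun t h1 => by
    simp only [hβ, show ¬ t ≤ k by omega, show ¬ t ≤ k + d by omega, if_false]
  clear_value α β
  clear hα hβ
  have hg1 := hg k (by omega)
  have hg2 := hg (k + d + 1) (by omega)
  have hαmono : ∀ t < P + 1, α t ≤ α (t + 1) := by
    intro t ht
    rcases lt_trichotomy t k with h | rfl | h
    · rw [hα1 t h.le, hα1 (t + 1) h]; exact hfm t (by omega)
    · rw [hα1 t le_rfl, hα2 (t + 1) le_rfl (by omega)]; exact hk1.trans hg1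
    · rcases lt_trichotomy t (k + d + 1) with h' | rfl | h'
      · rw [hα2 t h h'.le, hα2 (t + 1) (by omega) h']; exact hg t ht
      · rw [hα2 _ h le_rfl, hα3 _ le_rfl]; exact hg2.trans hm2.le
      · obtain ⟨u, rfl⟩ : ∃ u, t = u + 1 := ⟨t - 1, by omega⟩
        rw [hα3 u (by omega), hα3 (u + 1) (by omega)]; exact hfm u (by omega)
  have hβmono : ∀ t < P, β t ≤ β (t + 1) := by
    intro t ht
    rcases lt_trichotomy t k with h | rfl | h
    · rw [hβ1 t h.le, hβ1 (t + 1) h]; exact hg t (by omega)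
    · rw [hβ1 t le_rfl]
      rcases Nat.eq_zero_or_pos d with rfl | hd
      · rw [hβ3 (t + 1) (by omega)]; exact hg1.trans hg2
      · rw [hβ2 (t + 1) le_rfl (by omega)]; exact hg1.trans hk2.le
    · rcases lt_trichotomy t (k + d) with h' | rfl | h'
      · rw [hβ2 t h h'.le, hβ2 (t + 1) (by omega) h']; exact hfm t ht
      · rw [hβ2 _ h le_rfl, hβ3 _ le_rfl]; exact hm1.trans hg2
      · rw [hβ3 t (by omega), hβ3 (t + 1) (by omega)]; exact hg _ (by omega)
  have hα0 : α 0 = f 0 := hα1 0 (Nat.zero_le _)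
  have hαP : α (P + 1) = f P := hα3 P hmP
  have hβ0 : β 0 = g 0 := hβ1 0 (Nat.zero_le _)
  have hβP : β P = g (P + 1) := hβ3 P hmP
  -- the energy gained at the first switch, and the fact that nothing is lost at the second
  have hle : pathEnergy U V α (P + 1) + pathEnergy U V β P +
      ((U (f k - f (k + 1)) + U (g k - g (k + 1))) - (U (f k - g (k + 1)) + U (g k - f (k + 1)))) ≤
      pathEnergy U V f P + pathEnergy U V g (P + 1) := by
    obtain ⟨n, rfl⟩ := Nat.exists_eq_add_of_le hmP
    have tail1 : pathEnergy U V (fun t => α (k + d + 2 + t)) n =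
        pathEnergy U V (fun t => f (k + d + 1 + t)) n :=
      pathEnergy_congr fun t _ => by
        rw [show k + d + 2 + t = k + d + 1 + t + 1 by omega, hα3 _ (by omega)]
    have tail2 : pathEnergy U V (fun t => β (k + d + 1 + t)) n =
        pathEnergy U V (fun t => g (k + d + 2 + t)) n :=
      pathEnergy_congr fun t _ => by
        rw [hβ3 _ (by omega), show k + d + 1 + t + 1 = k + d + 2 + t by omega]
    have head1 : pathEnergy U V α k = pathEnergy U V f k := pathEnergy_congr hα1
    have head2 : pathEnergy U V β k = pathEnergy U V g k := pathEnergy_congr hβ1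
    rcases Nat.eq_zero_or_pos d with rfl | hd
    · have E1 : ∀ x : ℕ → ℝ, pathEnergy U V x (k + 0 + 1 + n) = pathEnergy U V x k +
          (U (x k - x (k + 1)) + V (x k)) + pathEnergy U V (fun t => x (k + 0 + 1 + t)) n := by
        intro x
        rw [pathEnergy_add x (k + 0 + 1) n]
        simp only [pathEnergy, add_zero, Finset.sum_range_succ]
      have E2 : ∀ x : ℕ → ℝ, pathEnergy U V x (k + 0 + 1 + n + 1) = pathEnergy U V x k +
          (U (x k - x (k + 1)) + V (x k)) + (U (x (k + 1) - x (k + 2)) + V (x (k + 1))) +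
          pathEnergy U V (fun t => x (k + 0 + 2 + t)) n := by
        intro x
        rw [show k + 0 + 1 + n + 1 = k + 2 + n by omega, pathEnergy_add x (k + 2) n]
        simp only [pathEnergy, add_zero, Finset.sum_range_succ]
      rw [E1, E1, E2, E2, tail1, tail2, head1, head2, hα1 k le_rfl, hα2 (k + 1) le_rfl (by omega),
        hα3 (k + 1) (by omega), hβ1 k le_rfl, hβ3 (k + 1) (by omega)]
      simp only [add_zero] at hg2 hm2
      have := swap_le hconv hg1 hm2.le
      simp only [add_assoc, Nat.reduceAdd] at this ⊢
      linarith
    · obtain ⟨e, rfl⟩ : ∃ e, d = e + 1 := ⟨d - 1, by omega⟩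
      have E1 : ∀ x : ℕ → ℝ, pathEnergy U V x (k + (e + 1) + 1 + n) = pathEnergy U V x k +
          (U (x k - x (k + 1)) + V (x k)) + pathEnergy U V (fun t => x (k + 1 + t)) e +
          (U (x (k + e + 1) - x (k + e + 2)) + V (x (k + e + 1))) +
          pathEnergy U V (fun t => x (k + (e + 1) + 1 + t)) n := by
        intro x
        rw [pathEnergy_add x (k + (e + 1) + 1) n, pathEnergy_succ x (k + (e + 1)),
          show k + (e + 1) = k + 1 + e by omega, pathEnergy_add x (k + 1) e, pathEnergy_succ x k,
          show k + 1 + e = k + e + 1 by omega]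
      have E2 : ∀ x : ℕ → ℝ, pathEnergy U V x (k + (e + 1) + 1 + n + 1) = pathEnergy U V x k +
          (U (x k - x (k + 1)) + V (x k)) + pathEnergy U V (fun t => x (k + 1 + t)) (e + 1) +
          (U (x (k + e + 2) - x (k + e + 3)) + V (x (k + e + 2))) +
          pathEnergy U V (fun t => x (k + (e + 1) + 2 + t)) n := by
        intro x
        rw [show k + (e + 1) + 1 + n + 1 = k + (e + 1) + 1 + 1 + n by omega,
          pathEnergy_add x (k + (e + 1) + 1 + 1) n, pathEnergy_succ x (k + (e + 1) + 1),
          show k + (e + 1) + 1 = k + 1 + (e + 1) by omega, pathEnergy_add x (k + 1) (e + 1),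
          pathEnergy_succ x k, show k + 1 + (e + 1) = k + e + 2 by omega]
        rfl
      have mid1 : pathEnergy U V (fun t => α (k + 1 + t)) (e + 1) =
          pathEnergy U V (fun t => g (k + 1 + t)) (e + 1) :=
        pathEnergy_congr fun t ht => hα2 _ (by omega) (by omega)
      have mid2 : pathEnergy U V (fun t => β (k + 1 + t)) e =
          pathEnergy U V (fun t => f (k + 1 + t)) e :=
        pathEnergy_congr fun t ht => hβ2 _ (by omega) (by omega)
      rw [E1, E1, E2, E2, tail1, tail2, head1, head2, mid1, mid2, hα1 k le_rfl,
        hα2 (k + 1) le_rfl (by omega), hα2 (k + e + 2) (by omega) (by omega),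
        hα3 (k + e + 2) (by omega), hβ1 k le_rfl, hβ2 (k + 1) le_rfl (by omega),
        hβ2 (k + e + 1) (by omega) (by omega), hβ3 (k + e + 2) (by omega)]
      simp only [show k + (e + 1) = k + e + 1 by omega, show k + e + 1 + 1 = k + e + 2 by omega,
        show k + e + 2 + 1 = k + e + 3 by omega] at hg2 hm2 hm1 ⊢
      have := swap_le hconv hm1 hm2.le
      linarith
  have hge := hmin α β hαmono hβmono hα0 hαP hβ0 hβP
  rcases hk1.lt_or_eq with hlt | heq
  · have := swap_lt hconv hlt hk2
    linarith
  · -- the paths touch before crossing: the new path is minimal but breaks away from `f`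
    have hαmin : IsMinimalPath U V α (P + 1) := by
      refine ⟨hαmono, fun γ hγ hγ0 hγP => ?_⟩
      have := hmin γ β hγ hβmono (hγ0.trans hα0) (hγP.trans hαP) hβ0 hβP
      have := swap_le hconv hk1 hk2.le
      linarith
    have h1 : IsMinimalPath U V f (k + 1) := by simpa using hf.sub (i := 0) (p := k + 1) (by omega)
    have h2 : IsMinimalPath U V α (k + 1) := by
      simpa using hαmin.sub (i := 0) (p := k + 1) (by omega)
    refine h1.not_lt_of_agree hU hU' hV h2 hα1 ?_ ?_
    · rw [heq]
      exact h0.trans_le (le_of_steps hg (Nat.zero_le _) (by omega))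
    · rw [hα2 (k + 1) le_rfl (by omega)]; exact hk2

/-! ### Atoms of a minimal path in two windows where the potential is the same -/

theorem pathEnergy_translate {τ : ℝ} {f : ℕ → ℝ} {p : ℕ} (h : ∀ t < p, V (f t - τ) = V (f t)) :
    pathEnergy U V (fun t => f t - τ) p = pathEnergy U V f p := by
  refine Finset.sum_congr rfl fun t ht => ?_
  rw [h t (Finset.mem_range.1 ht), sub_sub_sub_cancel_right]

theorem false_of_windows (hU : Differentiable ℝ U) (hU' : StrictMono (deriv U))
    (hV : Differentiable ℝ V) {f : ℕ → ℝ} {N i j P : ℕ} {x y L : ℝ} (hf : IsMinimalPath U V f N)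
    (hVxy : ∀ t, 0 ≤ t → t ≤ L → V (x + t) = V (y + t)) (hiN : i + P ≤ N) (hjN : j + (P + 1) ≤ N)
    (hij : i + P ≤ j ∨ j + (P + 1) ≤ i) (hfy : f i < y) (hyf : y + L < f (i + P))
    (hxf : x ≤ f j) (hfx : f (j + (P + 1)) ≤ x + L) : False := by
  have hmono := hf.1
  refine false_of_crossing hU hU' hV (f := fun t => f (i + t)) (P := P)
    (g := fun t => f (j + t) + (y - x)) (hf.sub hiN)
    (fun t ht => by have := hmono (j + t) (by omega); simpa [add_assoc] using this)
    (by simp only [add_zero]; linarith) (by linarith) fun α β hα hβ hα0 hαP hβ0 hβP => ?_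
  have htr : ∀ z, y ≤ z → z ≤ y + L → V (z - (y - x)) = V z := fun z h1 h2 => by
    have := hVxy (z - y) (by linarith) (by linarith)
    rwa [show x + (z - y) = z - (y - x) by ring, show y + (z - y) = z by ring] at this
  have e1 : pathEnergy U V (fun t => f (j + t) + (y - x)) (P + 1) =
      pathEnergy U V (fun t => f (j + t)) (P + 1) := by
    rw [← pathEnergy_translate (τ := y - x)]
    · simp
    · intro t ht
      refine htr _ ?_ ?_
      · have := le_of_steps hmono (Nat.le_add_right j t) (by omega)
        linarith
      · have := le_of_steps hmono (show j + t ≤ j + (P + 1) by omega) (by omega)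
        linarith
  simp only [add_zero] at hβ0
  have e2 : pathEnergy U V (fun t => β t - (y - x)) P = pathEnergy U V β P := by
    refine pathEnergy_translate fun t ht => htr _ ?_ ?_
    · have := le_of_steps hβ (Nat.zero_le t) ht.le
      linarith
    · have := le_of_steps hβ ht.le le_rfl
      linarith
  rw [e1, ← e2]
  have hβ' : ∀ t < P, β t - (y - x) ≤ β (t + 1) - (y - x) := fun t ht => by
    have := hβ t ht; linarith
  rcases hij with hij | hij
  · obtain ⟨h, rfl⟩ := Nat.exists_eq_add_of_le hij
    have hs : IsMinimalPath U V (fun t => f (i + t)) (P + h + (P + 1)) := hf.sub (by omega)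
    have := hs.exchange (p' := P + 1) (q' := P) (by omega) hα hβ' hα0 hαP
      (by simp only [← add_assoc]; linarith)
      (by simp only [← add_assoc] at hβP ⊢; linarith)
    simpa only [← add_assoc] using this
  · obtain ⟨h, rfl⟩ := Nat.exists_eq_add_of_le hij
    have hs : IsMinimalPath U V (fun t => f (j + t)) ((P + 1) + h + P) := hf.sub (by omega)
    have := hs.exchange (p' := P) (q' := P + 1) (by omega) hβ' hα
      (by simp only [add_zero]; linarith)
      (by linarith)
      (by rw [hα0]; simp only [← add_assoc, add_zero])
      (by rw [hαP]; simp only [← add_assoc])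
    simp only [← add_assoc] at this ⊢
    linarith

/-- If the potential is the same in two disjoint windows, and `Q + 1` atoms lie in the first one,
then every piece of the path that crosses the second one has at least `Q` steps. -/
theorem IsMinimalPath.card_le_of_windows (hU : Differentiable ℝ U) (hU' : StrictMono (deriv U))
    (hV : Differentiable ℝ V) {f : ℕ → ℝ} {N i j P Q : ℕ} {x y L : ℝ} (hf : IsMinimalPath U V f N)
    (hVxy : ∀ t, 0 ≤ t → t ≤ L → V (x + t) = V (y + t)) (hiN : i + P ≤ N) (hjN : j + Q ≤ N)
    (hxy : y + L < x ∨ x + L < y) (hfy : f i < y) (hyf : y + L < f (i + P))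
    (hxf : x ≤ f j) (hfx : f (j + Q) ≤ x + L) : Q ≤ P := by
  classical
  by_contra hQP
  have hmono := hf.1
  rcases hxy with hxy | hxy
  · have hex : ∃ t, y + L < f (i + t) := ⟨P, hyf⟩
    have hle : Nat.find hex ≤ P := Nat.find_min' hex hyf
    refine false_of_windows hU hU' hV (i := i) (j := j) (P := Nat.find hex) (L := L) hf hVxy
      (by omega) (by omega) (Or.inl ?_) hfy (Nat.find_spec hex) hxf
      ((le_of_steps hmono (by omega) hjN).trans hfx)
    by_contra h
    have hji : i ≤ j := by
      by_contra hji
      have := le_of_steps hmono (show j ≤ i by omega) (by omega)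
      have := le_of_steps hmono (Nat.le_add_right j Q) hjN
      linarith
    refine Nat.find_min hex (m := j - i) (by omega) ?_
    have := le_of_steps hmono (show j ≤ i + (j - i) by omega) (by omega)
    linarith
  · obtain ⟨k, ⟨hkP, hk⟩, hmax⟩ : ∃ k, (k ≤ P ∧ f (i + k) < y) ∧
        ∀ t, t ≤ P ∧ f (i + t) < y → t ≤ k := by
      refine ⟨Nat.findGreatest (fun t => f (i + t) < y) P, ⟨Nat.findGreatest_le P, ?_⟩, ?_⟩
      · exact Nat.findGreatest_spec (P := fun t => f (i + t) < y) (Nat.zero_le P) hfy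
      · exact fun t ht => Nat.le_findGreatest ht.1 ht.2
    have hjk : j + Q ≤ i + k := by
      by_contra h
      by_cases hjQ : j + Q ≤ i + P
      · have := hmax (j + Q - i) ⟨by omega, by rw [show i + (j + Q - i) = j + Q by omega]; linarith⟩
        omega
      · have := le_of_steps hmono (show i + P ≤ j + Q by omega) hjN
        have := le_of_steps hmono (Nat.le_add_right j Q) hjN
        linarith
    refine false_of_windows hU hU' hV (i := i + k) (j := j) (P := P - k) (L := L) hf hVxy
      (by omega) (by omega) (Or.inr (by omega)) hk
      (by rwa [show i + k + (P - k) = i + P by omega]) hxf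
      ((le_of_steps hmono (by omega) hjN).trans hfx)

/-- The number of atoms of the path `(f 0, …, f N)` that lie strictly to the left of `x`. -/
noncomputable def atomCount (f : ℕ → ℝ) (N : ℕ) (x : ℝ) : ℕ :=
  ((Finset.range (N + 1)).filter fun t => f t < x).card

theorem atomCount_mono (f : ℕ → ℝ) (N : ℕ) : Monotone (atomCount f N) := fun x y hxy =>
  Finset.card_le_card fun t ht => by
    simp only [Finset.mem_filter] at ht ⊢
    exact ⟨ht.1, ht.2.trans_le hxy⟩

theorem lt_atomCount_iff {f : ℕ → ℝ} {N : ℕ} (hf : ∀ t < N, f t ≤ f (t + 1)) {t : ℕ} (ht : t ≤ N)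
    {x : ℝ} : t < atomCount f N x ↔ f t < x := by
  constructor
  · intro h
    by_contra hx
    have hsub : ((Finset.range (N + 1)).filter fun t => f t < x) ⊆ Finset.range t := fun u hu => by
      simp only [Finset.mem_filter, Finset.mem_range] at hu ⊢
      by_contra htu
      have := le_of_steps hf (not_lt.1 htu) (by omega)
      linarith
    have := Finset.card_le_card hsub
    rw [Finset.card_range] at this
    exact absurd h (not_lt.2 this)
  · intro h
    have hsub : Finset.range (t + 1) ⊆ (Finset.range (N + 1)).filter fun t => f t < x :=
      fun u hu => by
      simp only [Finset.mem_filter, Finset.mem_range] at hu ⊢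
      exact ⟨by omega, (le_of_steps hf (by omega) ht).trans_lt h⟩
    have := Finset.card_le_card hsub
    rwa [Finset.card_range] at this

theorem atomCount_le {f : ℕ → ℝ} {N : ℕ} {x : ℝ} (hx : x ≤ f N)
    (hf : ∀ t < N, f t ≤ f (t + 1)) : atomCount f N x ≤ N := by
  by_contra h
  have := (lt_atomCount_iff hf le_rfl).1 (not_le.1 h)
  linarith

/-- The numbers of atoms in two disjoint half-open windows where the potential is the same satisfy a
one-sided comparison; only the second window has to be inside the range of the path. -/
theorem IsMinimalPath.atomCount_sub_le (hU : Differentiable ℝ U) (hU' : StrictMono (deriv U))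
    (hV : Differentiable ℝ V) {f : ℕ → ℝ} {N : ℕ} {x y L : ℝ} (hf : IsMinimalPath U V f N)
    (hL : 0 ≤ L) (hVxy : ∀ t, 0 ≤ t → t ≤ L → V (x + t) = V (y + t))
    (hxy : y + L ≤ x ∨ x + L ≤ y) (hy : f 0 < y) (hyL : y + L ≤ f N) :
    (atomCount f N (x + L) : ℝ) - atomCount f N x ≤
      atomCount f N (y + L) - atomCount f N y + 2 := by
  have hmono := hf.1
  have m1 : atomCount f N x ≤ atomCount f N (x + L) := atomCount_mono f N (by linarith)
  have m2 : atomCount f N y ≤ atomCount f N (y + L) := atomCount_mono f N (by linarith)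
  suffices h : atomCount f N (x + L) + atomCount f N y ≤
      atomCount f N (y + L) + atomCount f N x + 2 by
    have : ((atomCount f N (x + L) + atomCount f N y : ℕ) : ℝ) ≤
      ((atomCount f N (y + L) + atomCount f N x + 2 : ℕ) : ℝ) := by exact_mod_cast h
    push_cast at this
    linarith
  rcases m1.eq_or_lt with heq | hlt
  · omega
  obtain ⟨Q, hQ⟩ := Nat.exists_eq_add_of_lt hlt
  have hcard : atomCount f N (x + L) ≤ N + 1 := by
    refine (Finset.card_filter_le _ _).trans ?_
    simp
  have hjN : atomCount f N x + Q ≤ N := by omega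
  have hy1 : 0 < atomCount f N y := (lt_atomCount_iff hmono (Nat.zero_le _)).2 hy
  have hyN := atomCount_le hyL hmono
  have hxf : x ≤ f (atomCount f N x) := by
    by_contra h
    exact lt_irrefl _ ((lt_atomCount_iff hmono (by omega)).2 (not_le.1 h))
  have hfx : f (atomCount f N x + Q) < x + L :=
    (lt_atomCount_iff hmono hjN).1 (by omega)
  have hfy : f (atomCount f N y - 1) < y := (lt_atomCount_iff hmono (by omega)).1 (by omega)
  have hyf : y + L ≤ f (atomCount f N (y + L)) := by
    by_contra h
    exact lt_irrefl _ ((lt_atomCount_iff hmono hyN).2 (not_le.1 h))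
  have hfx' : x ≤ f (atomCount f N x + Q) :=
    hxf.trans (le_of_steps hmono (Nat.le_add_right _ _) hjN)
  obtain ⟨P, hP⟩ := Nat.exists_eq_add_of_le
    (show atomCount f N y - 1 ≤ atomCount f N (y + L) by omega)
  have := hf.card_le_of_windows hU hU' hV (i := atomCount f N y - 1) (j := atomCount f N x)
    (P := P) (Q := Q) (x := x) (y := y) (L := f (atomCount f N x + Q) - x)
    (fun t h0 h1 => hVxy t h0 (by linarith)) (by omega) hjN
    (by rcases hxy with h | h <;> [left; right] <;> linarith) hfy
    (by rw [← hP]; linarith) hxf (by linarith)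
  omega

/-! ### Recurrence of the potential -/

theorem SegmentEquiv.refl (s : ℤ → ℝ) (n : ℤ) (p : ℕ) : SegmentEquiv s n n p :=
  ⟨0, fun _ _ => (add_zero _).symm⟩

theorem SegmentEquiv.symm {n q : ℤ} {p : ℕ} (h : SegmentEquiv s n q p) : SegmentEquiv s q n p := by
  obtain ⟨τ, h⟩ := h
  exact ⟨-τ, fun i hi => by rw [h i hi]; ring⟩

theorem SegmentEquiv.trans {n q m : ℤ} {p : ℕ} (h : SegmentEquiv s n q p)
    (h' : SegmentEquiv s q m p) : SegmentEquiv s n m p := by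
  obtain ⟨τ, h⟩ := h
  obtain ⟨τ', h'⟩ := h'
  exact ⟨τ + τ', fun i hi => by rw [h' i hi, h i hi]; ring⟩

/-- If two segments of the chain are equivalent, the potential takes the same values at
corresponding points that are at distance at least the range from the endpoints. -/
theorem HasRange.eq_of_segmentEquiv (hs : Monotone s) {R : ℝ} (hV : HasRange s V R) {n q : ℤ}
    {p : ℕ} {τ z : ℝ} (h : ∀ i : ℕ, i ≤ p → s (q + i) = s (n + i) + τ) (h1 : s n ≤ z - R)
    (h2 : z + R ≤ s (n + p)) : V z = V (z + τ) := by
  have hq : s q = s n + τ := by simpa using h 0 (Nat.zero_le p)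
  have hqp := h p le_rfl
  have hloc : ∀ (a : ℤ) (c : ℝ), s a ≤ c - R → c + R ≤ s (a + p) → ∀ m : ℤ,
      s m ∈ Metric.ball c R → ∃ i : ℕ, i ≤ p ∧ m = a + i := by
    intro a c ha hap m hm
    rw [Real.ball_eq_Ioo, Set.mem_Ioo] at hm
    have hlt : a < m := hs.reflect_lt (ha.trans_lt hm.1)
    have hlt' : m < a + p := hs.reflect_lt (hm.2.trans_le hap)
    exact ⟨(m - a).toNat, by omega, by omega⟩
  refine hV z (z + τ) (Set.ext fun w => ⟨?_, ?_⟩)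
  · rintro ⟨_, ⟨⟨m, rfl⟩, hm⟩, rfl⟩
    obtain ⟨i, hi, rfl⟩ := hloc n z h1 h2 m hm
    refine ⟨s (q + i), ⟨⟨_, rfl⟩, ?_⟩, ?_⟩
    · rw [h i hi, Metric.mem_ball, dist_add_right]
      exact hm
    · simp only [h i hi]
      ring
  · rintro ⟨_, ⟨⟨m, rfl⟩, hm⟩, rfl⟩
    obtain ⟨i, hi, rfl⟩ := hloc q (z + τ) (by linarith) (by linarith) m hm
    rw [h i hi, Metric.mem_ball, dist_add_right] at hm
    refine ⟨s (n + i), ⟨⟨_, rfl⟩, hm⟩, ?_⟩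
    simp only [h i hi]
    ring

theorem le_add_mul_gap {G : ℝ} (hG : ∀ n : ℤ, s (n + 1) ≤ s n + G) (n : ℤ) (k : ℕ) :
    s (n + k) ≤ s n + k * G := by
  induction k with
  | zero => simp
  | succ k ih =>
    have := hG (n + k)
    push_cast
    rw [← add_assoc]
    linarith

namespace IsQuasicrystal

theorem exists_gap (hs : IsQuasicrystal s) : ∃ G : ℝ, 0 < G ∧ ∀ n : ℤ, s (n + 1) ≤ s n + G := by
  obtain ⟨R, hR, h⟩ := hs.repetitive 0 0
  refine ⟨2 * R, by linarith, fun n => ?_⟩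
  obtain ⟨q, -, hq⟩ := h (s n + R)
  have := hq 0 le_rfl
  rw [Real.ball_eq_Ioo, Set.mem_Ioo] at this
  simp only [Nat.cast_zero, add_zero] at this
  have hnq : n < q := hs.monotone.reflect_lt (by linarith)
  have := hs.monotone (Int.add_one_le_of_lt hnq)
  linarith

theorem exists_spread (hs : IsQuasicrystal s) {M : ℝ} (hM : 0 < M) :
    ∃ r : ℕ, 0 < r ∧ ∀ n : ℤ, s n + M ≤ s (n + r) := by
  obtain ⟨F, hF, h⟩ := hs.finiteLocalComplexity M hM
  obtain ⟨b, hb⟩ := (hF.image Prod.snd).bddAbove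
  refine ⟨b + 1, Nat.succ_pos b, fun n => ?_⟩
  by_contra hn
  obtain ⟨q, hq, -⟩ := h n (b + 1) (by linarith)
  have := hb ⟨_, hq, rfl⟩
  simp at this

theorem exists_between (hs : IsQuasicrystal s) (x : ℝ) : ∃ n : ℤ, s n ≤ x ∧ x < s (n + 1) := by
  obtain ⟨R, -, h⟩ := hs.repetitive 0 0
  obtain ⟨a, -, ha⟩ := h (x - R)
  obtain ⟨b, -, hb⟩ := h (x + R)
  have ha := ha 0 le_rfl
  have hb := hb 0 le_rfl
  rw [Real.ball_eq_Ioo, Set.mem_Ioo] at ha hb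
  simp only [Nat.cast_zero, add_zero] at ha hb
  obtain ⟨n, hn, hmax⟩ := Int.exists_greatest_of_bdd (P := fun n => s n ≤ x)
    ⟨b, fun z hz => (hs.monotone.reflect_lt (show s z < s b by linarith)).le⟩ ⟨a, by linarith⟩
  refine ⟨n, hn, not_le.1 fun h => ?_⟩
  have := hmax _ h
  omega

/-- By finite local complexity, the radius in the definition of repetitivity can be chosen
uniformly for all segments of bounded diameter. -/
theorem exists_uniform_radius (hs : IsQuasicrystal s) {M : ℝ} (hM : 0 < M) :
    ∃ ρ : ℝ, 0 < ρ ∧ ∀ (n : ℤ) (p : ℕ), s (n + p) - s n < M → ∀ x : ℝ, ∃ q : ℤ,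
      SegmentEquiv s n q p ∧ ∀ i : ℕ, i ≤ p → s (q + i) ∈ Metric.ball x ρ := by
  obtain ⟨F, hF, h⟩ := hs.finiteLocalComplexity M hM
  choose R hR hrep using hs.repetitive
  obtain ⟨b, hb⟩ := (hF.image fun z : ℤ × ℕ => R z.1 z.2).bddAbove
  refine ⟨max b 1, by positivity, fun n p hnp x => ?_⟩
  obtain ⟨q₀, hq₀, he⟩ := h n p hnp
  obtain ⟨q, hq, hball⟩ := hrep q₀ p x
  refine ⟨q, he.symm.trans hq, fun i hi => Metric.ball_subset_ball ?_ (hball i hi)⟩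
  exact (hb ⟨_, hq₀, rfl⟩).trans (le_max_left _ _)

end IsQuasicrystal

/-- Every window of length `L` has a copy, with the same potential, inside every interval of length
`W`; moreover the copy can be chosen disjoint from two prescribed windows. -/
def IsUniformlyRecurrent (V : ℝ → ℝ) : Prop :=
  ∀ L : ℝ, 0 ≤ L → ∃ W : ℝ, 0 < W ∧ ∀ x u x₁ x₂ : ℝ, ∃ y : ℝ, u < y ∧ y + L < u + W ∧
    (y + L < x₁ ∨ x₁ + L < y) ∧ (y + L < x₂ ∨ x₂ + L < y) ∧
    ∀ t, 0 ≤ t → t ≤ L → V (x + t) = V (y + t)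

theorem IsQuasicrystal.isUniformlyRecurrent (hs : IsQuasicrystal s)
    (hV : IsShortRangePotential s V) : IsUniformlyRecurrent V := by
  intro L hL
  obtain ⟨R, hR, hV⟩ := hV
  obtain ⟨G, hG, hgap⟩ := hs.exists_gap
  obtain ⟨ρ, hρ, hrec⟩ := hs.exists_uniform_radius
    (show 0 < L + 2 * R + 2 * G + 1 by linarith)
  have hone : ∀ x c : ℝ, ∃ y : ℝ, c - ρ < y ∧ y + L < c + ρ ∧
      ∀ t, 0 ≤ t → t ≤ L → V (x + t) = V (y + t) := by
    intro x c
    obtain ⟨n, hn, hn'⟩ := hs.exists_between (x - R)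
    obtain ⟨m, hm, hm'⟩ := hs.exists_between (x + L + R)
    have hnm : n < m + 1 := hs.monotone.reflect_lt (by linarith)
    obtain ⟨p, hp⟩ : ∃ p : ℕ, m + 1 = n + p := ⟨(m + 1 - n).toNat, by omega⟩
    have h1 := hgap n
    have h2 := hgap m
    obtain ⟨q, ⟨τ, hτ⟩, hball⟩ := hrec n p (by rw [← hp]; linarith) c
    have hq0 := hτ 0 (Nat.zero_le _)
    have hqp := hτ p le_rfl
    have hb0 := hball 0 (Nat.zero_le _)
    have hbp := hball p le_rfl
    rw [Real.ball_eq_Ioo, Set.mem_Ioo] at hb0 hbp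
    simp only [Nat.cast_zero, add_zero] at hq0 hb0
    rw [← hp] at hqp
    refine ⟨x + τ, by linarith, by linarith, fun t ht0 htL => ?_⟩
    rw [hV.eq_of_segmentEquiv hs.monotone hτ (z := x + t) (by linarith)
      (by rw [← hp]; linarith)]
    congr 1
    ring
  refine ⟨3 * (2 * ρ + L), by positivity, fun x u x₁ x₂ => ?_⟩
  -- three copies, so far apart that each prescribed window meets at most one of them
  obtain ⟨y₀, h01, h02, h03⟩ := hone x (u + ρ)
  obtain ⟨y₁, h11, h12, h13⟩ := hone x (u + ρ + (2 * ρ + L))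
  obtain ⟨y₂, h21, h22, h23⟩ := hone x (u + ρ + 2 * (2 * ρ + L))
  by_contra hcon
  push Not at hcon
  have c0 := hcon y₀ (by linarith) (by linarith)
  have c1 := hcon y₁ (by linarith) (by linarith)
  have c2 := hcon y₂ (by linarith) (by linarith)
  have d : ∀ y, (∀ t, 0 ≤ t → t ≤ L → V (x + t) = V (y + t)) →
      ((y + L < x₁ ∨ x₁ + L < y) → (y + L < x₂ ∨ x₂ + L < y) →
        ∃ t, 0 ≤ t ∧ t ≤ L ∧ V (x + t) ≠ V (y + t)) →
      (x₁ ≤ y + L ∧ y ≤ x₁ + L) ∨ (x₂ ≤ y + L ∧ y ≤ x₂ + L) := by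
    intro y hy hc
    by_contra hd
    push Not at hd
    have e : ∀ x', (x' ≤ y + L → x' + L < y) → y + L < x' ∨ x' + L < y := fun x' h => by
      rcases lt_or_ge (y + L) x' with h' | h'
      exacts [Or.inl h', Or.inr (h h')]
    obtain ⟨t, ht0, htL, ht⟩ := hc (e _ hd.1) (e _ hd.2)
    exact ht (hy t ht0 htL)
  rcases d y₀ h03 c0 with a | a <;> rcases d y₁ h13 c1 with b | b <;>
    rcases d y₂ h23 c2 with c | c <;> linarith [a.1, a.2, b.1, b.2, c.1, c.2]

/-- If somewhere `P + 2` atoms of a minimal path lie in an interval of length `L`, then everywhere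
`P + 1` consecutive atoms lie in an interval of length `W`, where `W` depends on `L` only. -/
theorem IsUniformlyRecurrent.exists_le_add (hU : Differentiable ℝ U) (hU' : StrictMono (deriv U))
    (hV : Differentiable ℝ V) (hrec : IsUniformlyRecurrent V) {L : ℝ} (hL : 0 ≤ L) :
    ∃ W : ℝ, 0 < W ∧ ∀ (f : ℕ → ℝ) (N : ℕ), IsMinimalPath U V f N → ∀ i j P : ℕ, j + (P + 1) ≤ N →
      f (j + (P + 1)) ≤ f j + L → i + P ≤ N → f (i + P) ≤ f i + W := by
  obtain ⟨W, hW, h⟩ := hrec L hL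
  refine ⟨W, hW, fun f N hf i j P hj hjL hi => ?_⟩
  by_contra hlt
  obtain ⟨y, h1, h2, h3, -, h5⟩ := h (f j) (f i) (f j) (f j)
  have := hf.card_le_of_windows hU hU' hV h5 hi hj h3 h1 (by linarith) le_rfl hjL
  omega

/-! ### Uniform existence of the density of a minimal path -/

theorem add_le_of_sparse {f : ℕ → ℝ} {N Q : ℕ} (hQ : ∀ t, t + Q ≤ N → f t + 1 ≤ f (t + Q)) (t k : ℕ)
    (h : t + Q * k ≤ N) : f t + k ≤ f (t + Q * k) := by
  induction k with
  | zero => simp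
  | succ k ih =>
    rw [Nat.mul_succ, ← add_assoc] at h ⊢
    have h1 := ih (by omega)
    have h2 := hQ (t + Q * k) h
    push_cast
    linarith

theorem atomCount_le_add {f : ℕ → ℝ} {N Q : ℕ} (hf : ∀ t < N, f t ≤ f (t + 1))
    (hQ : ∀ t, t + Q ≤ N → f t + 1 ≤ f (t + Q)) {x y : ℝ} {k : ℕ} (hk : y ≤ x + k) :
    atomCount f N y ≤ atomCount f N x + Q * k := by
  by_contra h
  have hcard : atomCount f N y ≤ N + 1 := by
    refine (Finset.card_filter_le _ _).trans ?_
    simp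
  have h1 : x ≤ f (atomCount f N x) := by
    by_contra h'
    exact lt_irrefl _ ((lt_atomCount_iff hf (by omega)).2 (not_le.1 h'))
  have h2 : f (atomCount f N x + Q * k) < y := (lt_atomCount_iff hf (by omega)).1 (by omega)
  have h3 := add_le_of_sparse hQ (atomCount f N x) k (by omega)
  linarith

/-- The classes of segments with `p` steps and bounded diameter, through a finite set of
representatives: `cls q` represents the class of `(s q, …, s (q + p))`. -/
theorem IsQuasicrystal.exists_classes (hs : IsQuasicrystal s) (p : ℕ) :
    ∃ (Z : Finset ℤ) (cls : ℤ → ℤ), ∀ q, cls q ∈ Z ∧ ∀ z ∈ Z, (cls q = z ↔ SegmentEquiv s z q p) := by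
  classical
  obtain ⟨G, hG, hgap⟩ := hs.exists_gap
  obtain ⟨F, hF, h⟩ := hs.finiteLocalComplexity (p * G + 1) (by positivity)
  let S : Setoid ℤ := ⟨fun n q => SegmentEquiv s n q p,
    ⟨fun n => .refl s n p, fun h => h.symm, fun h h' => h.trans h'⟩⟩
  let cls : ℤ → ℤ := fun q => (Quotient.mk S q).out
  have hcls : ∀ q, SegmentEquiv s (cls q) q p := fun q => Quotient.mk_out (s := S) q
  have hcls' : ∀ n q, SegmentEquiv s n q p → cls n = cls q := fun n q hnq => by
    have : Quotient.mk S n = Quotient.mk S q := Quotient.sound hnq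
    simp only [cls, this]
  refine ⟨((hF.image Prod.fst).image cls).toFinset, cls, fun q => ⟨?_, fun z hz => ⟨?_, ?_⟩⟩⟩
  · have := le_add_mul_gap hgap q p
    obtain ⟨n, hn, hnq⟩ := h q p (by linarith)
    rw [Set.Finite.mem_toFinset]
    exact ⟨n, ⟨_, hn, rfl⟩, hcls' _ _ hnq⟩
  · rintro rfl
    exact hcls q
  · intro hzq
    rw [Set.Finite.mem_toFinset] at hz
    obtain ⟨n, -, rfl⟩ := hz
    rw [← hcls' _ _ hzq, ← hcls' _ _ (hcls n).symm]

theorem sum_range_shift_sub (φ : ℕ → ℝ) (m K : ℕ) :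
    ∑ l ∈ Finset.range m, (φ (l + K) - φ l) = ∑ k ∈ Finset.range K, (φ (m + k) - φ k) := by
  have h1 := Finset.sum_range_add φ m K
  have h2 := Finset.sum_range_add φ K m
  rw [add_comm K m] at h2
  simp only [Finset.sum_sub_distrib, add_comm _ K]
  linarith

/-- In a minimal path, windows that correspond to each other in equivalent segments of the chain
contain the same number of atoms, up to `4`: both are compared with a third window, disjoint from
them. -/
theorem IsMinimalPath.atomCount_sub_le_of_segmentEquiv (hU : Differentiable ℝ U)
    (hU' : StrictMono (deriv U)) (hV : Differentiable ℝ V) (hs : Monotone s) {R : ℝ}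
    (hR : HasRange s V R) {r K : ℕ} (hr : ∀ n : ℤ, s n + R ≤ s (n + r)) {L W : ℝ}
    (hW : ∀ x u x₁ x₂ : ℝ, ∃ y : ℝ, u < y ∧ y + L < u + W ∧
      (y + L < x₁ ∨ x₁ + L < y) ∧ (y + L < x₂ ∨ x₂ + L < y) ∧
      ∀ t, 0 ≤ t → t ≤ L → V (x + t) = V (y + t))
    {f : ℕ → ℝ} {N : ℕ} (hf : IsMinimalPath U V f N) (hfW : f 0 + W ≤ f N) {n q : ℤ}
    (hnq : SegmentEquiv s n q (r + K + r)) (hL : s (n + r + K) - s (n + r) ≤ L)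
    (hq0 : f 0 < s (q + r)) (hqN : s (q + r + K) ≤ f N) :
    (atomCount f N (s (n + r + K)) : ℝ) - atomCount f N (s (n + r)) ≤
      atomCount f N (s (q + r + K)) - atomCount f N (s (q + r)) + 4 := by
  obtain ⟨τ, hτ⟩ := hnq
  have e1 := hτ r (by omega)
  have e2 := hτ (r + K) (by omega)
  have e3 : s (n + r) ≤ s (n + r + K) := hs (by omega)
  push_cast at e2
  rw [← add_assoc, ← add_assoc] at e2
  obtain ⟨l, hl⟩ : ∃ l, l = s (n + r + K) - s (n + r) := ⟨_, rfl⟩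
  have hl0 : 0 ≤ l := by linarith
  obtain ⟨y, h1, h2, h3, h4, h5⟩ := hW (s (n + r)) (f 0) (s (n + r)) (s (q + r))
  have c1 := hf.atomCount_sub_le hU hU' hV (x := s (n + r)) (y := y) (L := l) hl0
    (fun t h0 h1 => h5 t h0 (by linarith)) (by rcases h3 with h | h <;> [left; right] <;> linarith)
    h1 (by linarith)
  have c2 := hf.atomCount_sub_le hU hU' hV (x := y) (y := s (q + r)) (L := l) hl0
    (fun t h0 h1 => by
      have a1 := hr n
      have a2 := hr (n + r + K)
      rw [← h5 t h0 (by linarith), hR.eq_of_segmentEquiv hs hτ (z := s (n + r) + t) (by linarith)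
        (by push_cast; rw [← add_assoc, ← add_assoc]; linarith), e1]
      congr 1
      ring)
    (by rcases h4 with h | h <;> [right; left] <;> linarith) hq0 (by linarith)
  rw [show s (n + r) + l = s (n + r + K) by linarith] at c1
  rw [show s (q + r) + l = s (q + r + K) by linarith] at c2
  linarith

theorem add_le_of_spread {r : ℕ} (hr : ∀ n : ℤ, s n + 1 ≤ s (n + r)) (n : ℤ)
    (k : ℕ) : s n + k ≤ s (n + (r * k : ℕ)) := by
  induction k with
  | zero => simp
  | succ k ih =>
    have := hr (n + (r * k : ℕ))
    rw [Nat.mul_succ, Nat.cast_add (r * k) r, ← add_assoc]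
    push_cast at this ih ⊢
    linarith

/-- The segments of the chain with `p` steps that lie in a long interval are numbered by consecutive
integers, starting close to the left end of the interval and stopping close to its right end. -/
theorem IsQuasicrystal.exists_segments (hs : IsQuasicrystal s) {G : ℝ}
    (hgap : ∀ n : ℤ, s (n + 1) ≤ s n + G) {p : ℕ} {a b : ℝ} (hab : (p + 1) * G ≤ b - a) :
    ∃ (n : ℤ) (m : ℕ), (∀ q : ℤ, a ≤ s q ∧ s (q + p) ≤ b ↔ n ≤ q ∧ q ≤ n + m) ∧
      a ≤ s n ∧ s n ≤ a + G ∧ s (n + m + p) ≤ b ∧ b ≤ s (n + m + p) + G := by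
  -- `n₀` is the last index with `s n₀ < a`, which needs a search of its own because of ties
  obtain ⟨n₀, h0, h0'⟩ : ∃ n₀ : ℤ, s n₀ < a ∧ a ≤ s (n₀ + 1) := by
    obtain ⟨u, hu, hu'⟩ := hs.exists_between a
    obtain ⟨v, hv, hv'⟩ := hs.exists_between (a - 1)
    obtain ⟨n, hn, hmax⟩ := Int.exists_greatest_of_bdd (P := fun n => s n < a)
      ⟨u, fun z hz => by
        have := hs.monotone.reflect_lt (show s z < s (u + 1) by linarith)
        omega⟩ ⟨v, by linarith⟩
    refine ⟨n, hn, not_lt.1 fun h => ?_⟩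
    have := hmax _ h
    omega
  obtain ⟨n₁, h1, h1'⟩ := hs.exists_between b
  have hg0 := hgap n₀
  have hg1 := hgap n₁
  have hlt : n₀ + 1 + p < n₁ + 1 := by
    refine hs.monotone.reflect_lt ?_
    have := le_add_mul_gap hgap (n₀ + 1) p
    linarith
  obtain ⟨m, hm⟩ : ∃ m : ℕ, n₁ = n₀ + 1 + m + p := ⟨(n₁ - (n₀ + 1) - p).toNat, by omega⟩
  refine ⟨n₀ + 1, m, fun q => ⟨fun ⟨hqa, hqb⟩ => ?_, fun ⟨hqn, hqm⟩ => ?_⟩, h0', by linarith,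
    hm ▸ h1, hm ▸ by linarith⟩
  · have c1 : n₀ < q := hs.monotone.reflect_lt (by linarith)
    have c2 : q + p < n₁ + 1 := hs.monotone.reflect_lt (by linarith)
    omega
  · exact ⟨h0'.trans (hs.monotone hqn), (hs.monotone (by omega)).trans h1⟩

/-- The numbers of atoms in the blocks `[s (n + r), s (n + r + K))`, added over the block positions
`n` inside `[f i, f j]`, give `K` times the number of steps from `i` to `j`, up to boundary terms
that depend neither on `i` and `j` nor on the path. -/
theorem abs_sum_blocks_sub_le (hs : Monotone s) {G : ℝ} {r K Q : ℕ} {f : ℕ → ℝ} {N : ℕ} {k₀ : ℕ}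
    (hG : 0 ≤ G) (hgap : ∀ n : ℤ, s (n + 1) ≤ s n + G)
    (hk₀ : ((r + K + r : ℕ) + 1) * G + 1 ≤ k₀) (hf : ∀ t < N, f t ≤ f (t + 1))
    (hQ : ∀ t, t + Q ≤ N → f t + 1 ≤ f (t + Q)) {i j : ℕ} (hi : i ≤ N) (hj : j ≤ N) {n : ℤ} {m : ℕ}
    (h1 : f i ≤ s n) (h2 : s n ≤ f i + G) (h3 : s (n + m + (r + K + r : ℕ)) ≤ f j)
    (h4 : f j ≤ s (n + m + (r + K + r : ℕ)) + G) :
    |∑ l ∈ Finset.range (m + 1), ((atomCount f N (s (n + l + r + K)) : ℝ) -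
        atomCount f N (s (n + l + r))) - K * ((j : ℝ) - i)| ≤ K * (2 * (Q * k₀)) := by
  set φ : ℕ → ℝ := fun l => atomCount f N (s (n + l + r)) with hφ
  have hsum : ∑ l ∈ Finset.range (m + 1), ((atomCount f N (s (n + l + r + K)) : ℝ) -
      atomCount f N (s (n + l + r))) = ∑ k ∈ Finset.range K, (φ (m + 1 + k) - φ k) := by
    rw [← sum_range_shift_sub φ (m + 1) K]
    refine Finset.sum_congr rfl fun l _ => ?_
    simp only [hφ]
    congr 4
    push_cast
    ring
  have hk1 : (1 : ℝ) ≤ k₀ := by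
    have : 0 ≤ ((r + K + r : ℕ) + 1) * G := by positivity
    linarith
  have hk1' : 1 ≤ k₀ := by exact_mod_cast hk1
  have hQk : Q * 1 ≤ Q * k₀ := Nat.mul_le_mul_left _ hk1'
  have hupper : ∀ t, t ≤ N → atomCount f N (f t) ≤ t := fun t ht => by
    by_contra h
    exact lt_irrefl _ ((lt_atomCount_iff hf ht).1 (not_le.1 h))
  have hlower : ∀ t, t ≤ N → t < atomCount f N (f t + 1) := fun t ht =>
    (lt_atomCount_iff hf ht).2 (by linarith)
  have hterm : ∀ k ∈ Finset.range K, |(φ (m + 1 + k) - φ k) - ((j : ℝ) - i)| ≤ 2 * (Q * k₀) := by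
    intro k hk
    have hkK := Finset.mem_range.1 hk
    -- the four bounds on the number of atoms to the left of the two block ends
    have a1 : atomCount f N (s (n + (m + 1 + k : ℕ) + r)) ≤ j :=
      (atomCount_mono f N ((hs (by push_cast; omega)).trans h3)).trans (hupper j hj)
    have a2 : j < atomCount f N (s (n + (m + 1 + k : ℕ) + r)) + Q * k₀ := by
      refine (hlower j hj).trans_le (atomCount_le_add hf hQ ?_)
      have hle := le_add_mul_gap hgap (n + (m + 1 + k : ℕ) + r) (r + K + r)
      have hmon := hs (show n + m + (r + K + r : ℕ) ≤
        n + (m + 1 + k : ℕ) + r + (r + K + r : ℕ) by push_cast; omega)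
      linarith
    have a3 : atomCount f N (s (n + k + r)) ≤ i + Q * k₀ := by
      refine (atomCount_le_add hf hQ (x := f i) (k := k₀) ?_).trans
        (Nat.add_le_add_right (hupper i hi) _)
      have hle := le_add_mul_gap hgap n (r + K + r)
      have hmon := hs (show n + k + r ≤ n + (r + K + r : ℕ) by push_cast; omega)
      linarith
    have a4 : i < atomCount f N (s (n + k + r)) + Q * 1 := by
      refine (hlower i hi).trans_le (atomCount_le_add hf hQ ?_)
      have hmon := hs (show n ≤ n + k + r by omega)
      push_cast
      linarith
    have b1 : φ (m + 1 + k) ≤ j := by simp only [hφ]; exact_mod_cast a1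
    have b2 : (j : ℝ) ≤ φ (m + 1 + k) + Q * k₀ := by simp only [hφ]; exact_mod_cast a2.le
    have b3 : φ k ≤ i + Q * k₀ := by simp only [hφ]; exact_mod_cast a3
    have b4 : (i : ℝ) ≤ φ k + Q * k₀ := by simp only [hφ]; exact_mod_cast (by omega)
    rw [abs_le]
    have : (0 : ℝ) ≤ Q * k₀ := by positivity
    constructor <;> linarith
  rw [hsum, show (K : ℝ) * ((j : ℝ) - i) = ∑ k ∈ Finset.range K, ((j : ℝ) - i) by
      rw [Finset.sum_const, Finset.card_range, nsmul_eq_mul],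
    ← Finset.sum_sub_distrib]
  refine (Finset.abs_sum_le_sum_abs _ _).trans ((Finset.sum_le_sum hterm).trans ?_)
  simp

/-- Sums of class functions over the segments in `[x, x + M]` are governed by the numbers of
occurrences of the classes. -/
theorem sum_range_class_eq {p : ℕ} {Z : Finset ℤ} {cls : ℤ → ℤ}
    (hcls : ∀ q, cls q ∈ Z ∧ ∀ z ∈ Z, (cls q = z ↔ SegmentEquiv s z q p)) (hs : Monotone s)
    {x M : ℝ} {n : ℤ} {m : ℕ}
    (hnm : ∀ q : ℤ, x ≤ s q ∧ s (q + p) ≤ x + M ↔ n ≤ q ∧ q ≤ n + m) (c : ℤ → ℝ) :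
    ∑ l ∈ Finset.range (m + 1), c (cls (n + l)) = ∑ z ∈ Z, segmentCount s z p x M * c z := by
  classical
  rw [← Finset.sum_fiberwise_of_maps_to (g := fun l : ℕ => cls (n + l)) (t := Z)
    fun l _ => (hcls _).1]
  refine Finset.sum_congr rfl fun z hz => ?_
  have hcount : segmentCount s z p x M =
      ((Finset.range (m + 1)).filter fun l : ℕ => cls (n + l) = z).card := by
    have himg : {q : ℤ | SegmentEquiv s z q p ∧ ∀ i : ℕ, i ≤ p → s (q + i) ∈ Set.Icc x (x + M)} =
        (((Finset.range (m + 1)).filter fun l : ℕ => cls (n + l) = z).image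
          fun l : ℕ => n + (l : ℤ) : Finset ℤ) := by
      ext q
      simp only [Set.mem_ofPred_eq, Finset.coe_image, Set.mem_image, Finset.mem_coe,
        Finset.mem_filter, Finset.mem_range]
      constructor
      · rintro ⟨he, hq⟩
        have h0 := (hq 0 (Nat.zero_le _)).1
        have hp := (hq p le_rfl).2
        simp only [Nat.cast_zero, add_zero] at h0
        obtain ⟨h1, h2⟩ := (hnm q).1 ⟨h0, hp⟩
        have hqn : n + ((q - n).toNat : ℤ) = q := by omega
        exact ⟨(q - n).toNat, ⟨by omega, by rw [hqn]; exact ((hcls q).2 z hz).2 he⟩, hqn⟩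
      · rintro ⟨l, ⟨hl, hlz⟩, rfl⟩
        obtain ⟨h1, h2⟩ := (hnm (n + l)).2 ⟨by omega, by omega⟩
        refine ⟨((hcls _).2 z hz).1 hlz, fun i hi => ⟨h1.trans (hs (by omega)), ?_⟩⟩
        exact (hs (by omega)).trans h2
    rw [segmentCount, himg, Set.ncard_coe_finset, Finset.card_image_of_injective]
    intro a b hab
    simpa using hab
  rw [hcount, Finset.sum_congr rfl fun l hl => by rw [(Finset.mem_filter.1 hl).2],
    Finset.sum_const, nsmul_eq_mul]

/-- The number of atoms per unit length of a minimal path is the same, up to `ε`, in all sufficiently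
long pieces of the path. How long they have to be depends only on `ε` and on a bound `Q` for the
local number of atoms, not on the path. -/
theorem IsQuasicrystal.exists_density (hU : Differentiable ℝ U) (hU' : StrictMono (deriv U))
    (hV : Differentiable ℝ V) (hs : IsQuasicrystal s) (hVs : IsShortRangePotential s V) {ε : ℝ}
    (hε : 0 < ε) (Q : ℕ) :
    ∃ M₀ : ℝ, 0 < M₀ ∧ ∀ (f : ℕ → ℝ) (N : ℕ), IsMinimalPath U V f N →
      (∀ t, t + Q ≤ N → f t + 1 ≤ f (t + Q)) → ∃ A : ℝ, ∀ i j : ℕ, i ≤ j → j ≤ N →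
        M₀ ≤ f j - f i → |((j : ℝ) - i) / (f j - f i) - A| ≤ ε := by
  classical
  have hrec := hs.isUniformlyRecurrent hVs
  obtain ⟨R, hR, hVR⟩ := hVs
  obtain ⟨G, hG, hgap⟩ := hs.exists_gap
  obtain ⟨r, hr0, hr⟩ := hs.exists_spread hR
  obtain ⟨D, hD0, hD⟩ := hs.exists_spread one_pos
  -- `4 * (2 * D) / K` bounds the error due to the blocks: `4` atoms per block, at most `2 * D`
  -- blocks per unit length
  obtain ⟨K, hK⟩ := exists_nat_gt (3 * (4 * (2 * D)) / ε + 1)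
  have hK1 : (1 : ℝ) < K := by
    have : 0 ≤ 3 * (4 * (2 * (D : ℝ))) / ε := by positivity
    linarith
  have hKε : 4 * (2 * (D : ℝ)) / K ≤ ε / 3 := by
    rw [div_le_iff₀ (by linarith)]
    have h1 : 3 * (4 * (2 * (D : ℝ))) / ε < K := by linarith
    rw [div_lt_iff₀ hε] at h1
    linarith
  obtain ⟨p, hp⟩ : ∃ p, p = r + K + r := ⟨_, rfl⟩
  obtain ⟨k₀, hk₀⟩ := exists_nat_ge (((p : ℝ) + 1) * G + 1)
  obtain ⟨Z, cls, hcls⟩ := hs.exists_classes p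
  obtain ⟨W, hW, hrecW⟩ := hrec (K * G) (by positivity)
  choose ν hν using fun z => hs.uniformPatternDistribution z p
  obtain ⟨B, hB⟩ : ∃ B : ℝ, B = Q * k₀ := ⟨_, rfl⟩
  have hB0 : 0 ≤ B := by rw [hB]; positivity
  obtain ⟨δ, hδ, hδε⟩ : ∃ δ : ℝ, 0 < δ ∧ Z.card * (δ * B) ≤ ε / 3 := by
    refine ⟨ε / (3 * (Z.card * B + 1)), by positivity, ?_⟩
    have h1 : (Z.card : ℝ) * B / (Z.card * B + 1) ≤ 1 := by
      rw [div_le_one (by positivity)]; linarith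
    calc (Z.card : ℝ) * (ε / (3 * (Z.card * B + 1)) * B)
        = ε / 3 * ((Z.card : ℝ) * B / (Z.card * B + 1)) := by field_simp
      _ ≤ ε / 3 * 1 := by gcongr
      _ = ε / 3 := mul_one _
  have hfreq : ∀ᶠ M in atTop, ∀ z ∈ Z, ∀ x : ℝ,
      |(segmentCount s z p x M : ℝ) / M - ν z| < δ := by
    rw [Filter.eventually_all_finset]
    intro z _
    filter_upwards [Metric.tendstoUniformly_iff.1 (hν z) δ hδ] with M hM x
    have := hM x
    rwa [Real.dist_eq, abs_sub_comm] at this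
  obtain ⟨M₁, hM₁⟩ := eventually_atTop.1 hfreq
  refine ⟨max (max M₁ 1) (max (max W ((p + 1) * G)) (3 * (2 * B) / ε)), by positivity,
    fun f N hf hQ => ?_⟩
  have hmono := hf.1
  by_cases hfW : f 0 + W ≤ f N
  swap
  · refine ⟨0, fun i j hij hj hM => absurd ?_ hfW⟩
    have h1 := le_of_steps hmono (Nat.zero_le i) (hij.trans hj)
    have h2 := le_of_steps hmono hj le_rfl
    have h3 : W ≤ max (max M₁ 1) (max (max W ((p + 1) * G)) (3 * (2 * B) / ε)) := by simp
    linarith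
  -- the common value of the block counts over a class, up to `4`
  have hval : ∀ z : ℤ, ∃ c : ℝ, |c| ≤ B ∧ ∀ q : ℤ, cls q = z → f 0 ≤ s q → s (q + p) ≤ f N →
      |((atomCount f N (s (q + r + K)) : ℝ) - atomCount f N (s (q + r))) - c| ≤ 4 := by
    intro z
    by_cases hz : ∃ q : ℤ, cls q = z ∧ f 0 ≤ s q ∧ s (q + p) ≤ f N
    swap
    · exact ⟨0, by simpa using hB0, fun q h1 h2 h3 => absurd ⟨q, h1, h2, h3⟩ hz⟩
    obtain ⟨n, hnz, hn0, hnN⟩ := hz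
    have hspan : ∀ q : ℤ, s (q + r + K) - s (q + r) ≤ K * G := fun q => by
      have := le_add_mul_gap hgap (q + r) K
      linarith
    refine ⟨(atomCount f N (s (n + r + K)) : ℝ) - atomCount f N (s (n + r)), ?_, fun q hqz hq0 hqN =>
      ?_⟩
    · have h1 : atomCount f N (s (n + r)) ≤ atomCount f N (s (n + r + K)) :=
        atomCount_mono f N (hs.monotone (by omega))
      have h2 : atomCount f N (s (n + r + K)) ≤ atomCount f N (s (n + r)) + Q * k₀ := by
        refine atomCount_le_add hmono hQ ?_
        have h3 := hspan n
        have h4 : (K : ℝ) * G ≤ (p + 1) * G := by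
          refine mul_le_mul_of_nonneg_right ?_ hG.le
          rw [hp]; push_cast
          have : (0 : ℝ) ≤ r := Nat.cast_nonneg r
          linarith
        linarith
      have h1' : (atomCount f N (s (n + r)) : ℝ) ≤ atomCount f N (s (n + r + K)) := by
        exact_mod_cast h1
      have h2' : (atomCount f N (s (n + r + K)) : ℝ) ≤ atomCount f N (s (n + r)) + B := by
        rw [hB]; exact_mod_cast h2
      rw [abs_le]
      constructor <;> linarith
    · have hnq : SegmentEquiv s n q (r + K + r) := by
        rw [← hp]
        have hzZ : z ∈ Z := hnz ▸ (hcls n).1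
        exact (((hcls n).2 z hzZ).1 hnz).symm.trans (((hcls q).2 z hzZ).1 hqz)
      have hin : ∀ q : ℤ, f 0 ≤ s q → s (q + p) ≤ f N →
          f 0 < s (q + r) ∧ s (q + r + K) ≤ f N := fun q h1 h2 => by
        have := hr q
        exact ⟨by linarith, (hs.monotone (by rw [hp]; push_cast; omega)).trans h2⟩
      have c1 := hf.atomCount_sub_le_of_segmentEquiv hU hU' hV hs.monotone hVR hr hrecW hfW hnq
        (hspan n) (hin q hq0 hqN).1 (hin q hq0 hqN).2
      have c2 := hf.atomCount_sub_le_of_segmentEquiv hU hU' hV hs.monotone hVR hr hrecW hfW hnq.symm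
        (hspan q) (hin n hn0 hnN).1 (hin n hn0 hnN).2
      rw [abs_le]
      constructor <;> linarith
  choose c hcB hc using hval
  refine ⟨(∑ z ∈ Z, ν z * c z) / K, fun i j hij hj hM => ?_⟩
  simp only [max_le_iff] at hM
  obtain ⟨⟨hM1, hM2⟩, ⟨-, hM3⟩, hM4⟩ := hM
  obtain ⟨M, hMdef⟩ : ∃ M, M = f j - f i := ⟨_, rfl⟩
  rw [← hMdef] at hM1 hM2 hM3 hM4 ⊢
  obtain ⟨n, m, hnm, h1, h2, h3, h4⟩ := hs.exists_segments hgap (p := p) (a := f i) (b := f i + M)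
    (by linarith)
  have hfj : f i + M = f j := by linarith
  -- at most `2 * D * M` blocks
  have hcard : ((m : ℝ) + 1) ≤ 2 * D * M := by
    have h5 : m + 1 ≤ D * (⌊M⌋₊ + 1) := by
      by_contra hcon
      have h8 := add_le_of_spread hD n (⌊M⌋₊ + 1)
      have h9 := hs.monotone (show n + (D * (⌊M⌋₊ + 1) : ℕ) ≤ n + m + p by omega)
      have h10 := Nat.lt_floor_add_one M
      push_cast at h8 h9
      linarith
    have h6 : (⌊M⌋₊ : ℝ) ≤ M := Nat.floor_le (by linarith)
    have h7 : ((m : ℝ) + 1) ≤ D * (⌊M⌋₊ + 1) := by exact_mod_cast h5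
    have h8 : (D : ℝ) * (⌊M⌋₊ + 1) ≤ D * (2 * M) := by gcongr; linarith
    linarith
  have hblocks := abs_sum_blocks_sub_le hs.monotone (r := r) (K := K) (Q := Q) hG.le hgap
    (by rw [← hp]; exact hk₀) hmono hQ (hij.trans hj) hj h1 h2 (by rw [← hp, ← hfj]; exact h3)
    (by rw [← hp, ← hfj]; exact h4)
  have hclass : |∑ l ∈ Finset.range (m + 1), ((atomCount f N (s (n + l + r + K)) : ℝ) -
      atomCount f N (s (n + l + r))) - ∑ l ∈ Finset.range (m + 1), c (cls (n + l))| ≤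
      4 * (2 * D * M) := by
    rw [← Finset.sum_sub_distrib]
    refine (Finset.abs_sum_le_sum_abs _ _).trans
      ((Finset.sum_le_card_nsmul _ _ 4 fun l hl => ?_).trans ?_)
    · have hlm := Finset.mem_range.1 hl
      obtain ⟨a1, a2⟩ := (hnm (n + l)).2 ⟨by omega, by omega⟩
      exact hc _ _ rfl ((le_of_steps hmono (Nat.zero_le i) (hij.trans hj)).trans a1)
        (a2.trans (hfj ▸ le_of_steps hmono hj le_rfl))
    · rw [Finset.card_range, nsmul_eq_mul]
      push_cast
      linarith
  rw [sum_range_class_eq hcls hs.monotone hnm] at hclass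
  have hM0 : 0 < M := by linarith
  have hfreqs : |∑ z ∈ Z, (segmentCount s z p (f i) M : ℝ) * c z - M * ∑ z ∈ Z, ν z * c z| ≤
      M * (ε / 3) := by
    rw [Finset.mul_sum, ← Finset.sum_sub_distrib]
    refine (Finset.abs_sum_le_sum_abs _ _).trans
      ((Finset.sum_le_card_nsmul _ _ (M * (δ * B)) fun z hz => ?_).trans ?_)
    · have h5 := hM₁ M hM1 z hz (f i)
      rw [show (segmentCount s z p (f i) M : ℝ) * c z - M * (ν z * c z) =
        M * (((segmentCount s z p (f i) M : ℝ) / M - ν z) * c z) by field_simp, abs_mul, abs_mul,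
        abs_of_pos hM0]
      exact mul_le_mul_of_nonneg_left (mul_le_mul h5.le (hcB z) (abs_nonneg _) hδ.le) hM0.le
    · rw [nsmul_eq_mul]
      calc (Z.card : ℝ) * (M * (δ * B)) = M * (Z.card * (δ * B)) := by ring
        _ ≤ M * (ε / 3) := mul_le_mul_of_nonneg_left hδε hM0.le
  have hK0 : (0 : ℝ) < K := by linarith
  -- add up the three errors
  have htotal : |K * ((j : ℝ) - i) - M * ∑ z ∈ Z, ν z * c z| ≤
      K * (2 * B) + 4 * (2 * D * M) + M * (ε / 3) := by
    rw [← hB] at hblocks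
    rw [abs_le] at hblocks hclass hfreqs ⊢
    constructor <;> linarith [hblocks.1, hblocks.2, hclass.1, hclass.2, hfreqs.1, hfreqs.2]
  rw [show ((j : ℝ) - i) / M - (∑ z ∈ Z, ν z * c z) / K =
    (K * ((j : ℝ) - i) - M * ∑ z ∈ Z, ν z * c z) / (K * M) by field_simp, abs_div,
    abs_of_pos (mul_pos hK0 hM0), div_le_iff₀ (mul_pos hK0 hM0)]
  refine htotal.trans ?_
  rw [div_le_iff₀ hK0] at hKε
  rw [div_le_iff₀ hε] at hM4
  have e1 : K * (2 * B) ≤ K * (M * (ε / 3)) := mul_le_mul_of_nonneg_left (by linarith) hK0.le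
  have e2 : M * (4 * (2 * D)) ≤ M * (ε / 3 * K) := mul_le_mul_of_nonneg_left hKε hM0.le
  have e3 : M * (ε / 3) * 1 ≤ M * (ε / 3) * K :=
    mul_le_mul_of_nonneg_left hK1.le (by positivity)
  linarith

/-! ### Minimal configurations -/

theorem segmentEnergy_eq_pathEnergy (θ : ℤ → ℝ) (i : ℤ) (p : ℕ) :
    segmentEnergy U V θ i p = pathEnergy U V (fun t => θ (i + t)) p := by
  refine Finset.sum_congr rfl fun t _ => ?_
  simp only [Nat.cast_add, Nat.cast_one, add_assoc]

theorem isMinimalPath_of_mem {θ : ℤ → ℝ} (hθ : θ ∈ minimalConfigurations U V) (i : ℤ) (p : ℕ) :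
    IsMinimalPath U V (fun t => θ (i + t)) p := by
  refine ⟨fun t _ => hθ.1 (by push_cast; omega), fun g hg h0 hp => ?_⟩
  have hmin := hθ.2 i p (fun n => g (min (n - i).toNat p))
    (fun a b hab => le_of_steps hg (by omega) (by omega)) (by simpa using h0)
    (by simpa using hp)
  rw [segmentEnergy_eq_pathEnergy, segmentEnergy_eq_pathEnergy] at hmin
  refine hmin.trans_eq (pathEnergy_congr fun t ht => ?_)
  simp [ht]

theorem mem_minimalConfigurations {θ : ℤ → ℝ} (hmono : Monotone θ)
    (h : ∀ (i : ℤ) (p : ℕ), IsMinimalPath U V (fun t => θ (i + t)) p) :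
    θ ∈ minimalConfigurations U V := by
  refine ⟨hmono, fun i p θ' hθ' h0 hp => ?_⟩
  rw [segmentEnergy_eq_pathEnergy, segmentEnergy_eq_pathEnergy]
  exact (h i p).2 _ (fun t _ => hθ' (by push_cast; omega)) (by simpa using h0) hp

theorem exists_le_add_of_mem (hU : Differentiable ℝ U) (hU' : StrictMono (deriv U))
    (hV : Differentiable ℝ V) (hrec : IsUniformlyRecurrent V) {L : ℝ} (hL : 0 ≤ L) :
    ∃ W : ℝ, 0 < W ∧ ∀ θ ∈ minimalConfigurations U V, ∀ (i j : ℤ) (P : ℕ),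
      θ (j + (P + 1 : ℕ)) ≤ θ j + L → θ (i + P) ≤ θ i + W := by
  obtain ⟨W, hW, h⟩ := hrec.exists_le_add hU hU' hV hL
  refine ⟨W, hW, fun θ hθ i j P hj => ?_⟩
  have := h (fun t => θ (min i j + t)) ((max i j - min i j).toNat + (P + 1))
    (isMinimalPath_of_mem hθ _ _) (i - min i j).toNat (j - min i j).toNat P (by omega)
    (by
      rw [show min i j + (((j - min i j).toNat + (P + 1) : ℕ) : ℤ) = j + (P + 1 : ℕ) by omega,
        show min i j + (((j - min i j).toNat : ℕ) : ℤ) = j by omega]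
      exact hj) (by omega)
  rwa [show min i j + (((i - min i j).toNat + P : ℕ) : ℤ) = i + P by omega,
    show min i j + (((i - min i j).toNat : ℕ) : ℤ) = i by omega] at this

theorem exists_density_of_mem (hU : Differentiable ℝ U) (hU' : StrictMono (deriv U))
    (hV : Differentiable ℝ V) (hs : IsQuasicrystal s) (hVs : IsShortRangePotential s V) {ε : ℝ}
    (hε : 0 < ε) (Q : ℕ) :
    ∃ M₀ : ℝ, 0 < M₀ ∧ ∀ θ ∈ minimalConfigurations U V, (∀ t : ℤ, θ t + 1 ≤ θ (t + Q)) →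
      ∀ i j k l : ℤ, i ≤ j → k ≤ l → M₀ ≤ θ j - θ i → M₀ ≤ θ l - θ k →
        |((j : ℝ) - i) / (θ j - θ i) - ((l : ℝ) - k) / (θ l - θ k)| ≤ ε := by
  obtain ⟨M₀, hM₀, h⟩ := hs.exists_density hU hU' hV hVs (half_pos hε) Q
  refine ⟨M₀, hM₀, fun θ hθ hQ i j k l hij hkl h1 h2 => ?_⟩
  obtain ⟨a, ha⟩ : ∃ a, a = min i k := ⟨_, rfl⟩
  obtain ⟨A, hA⟩ := h (fun t => θ (a + t)) (max j l - a).toNat (isMinimalPath_of_mem hθ _ _)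
    (fun t _ => by
      have := hQ (a + t)
      rw [add_assoc] at this
      exact_mod_cast this)
  have e : ∀ i : ℤ, a ≤ i → a + (((i - a).toNat : ℕ) : ℤ) = i := fun i hi => by omega
  have e' : ∀ i : ℤ, a ≤ i → (((i - a).toNat : ℕ) : ℝ) = (i : ℝ) - a := fun i hi => by
    have : (((i - a).toNat : ℕ) : ℤ) = i - a := by omega
    exact_mod_cast congrArg (fun z : ℤ => (z : ℝ)) this
  have c1 := hA (i - a).toNat (j - a).toNat (by omega) (by omega)
  have c2 := hA (k - a).toNat (l - a).toNat (by omega) (by omega)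
  rw [e i (by omega), e j (by omega), e' i (by omega), e' j (by omega),
    sub_sub_sub_cancel_right] at c1
  rw [e k (by omega), e l (by omega), e' k (by omega), e' l (by omega),
    sub_sub_sub_cancel_right] at c2
  have c1 := abs_le.1 (c1 h1)
  have c2 := abs_le.1 (c2 h2)
  rw [abs_le]
  constructor <;> linarith [c1.1, c1.2, c2.1, c2.2]

/-! ### Rotation numbers -/

theorem tendsto_const_div_intCast_atTop (c : ℝ) :
    Tendsto (fun n : ℤ => c / (n : ℝ)) atTop (𝓝 0) :=
  tendsto_const_nhds.div_atTop tendsto_intCast_atTop_atTop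

theorem tendsto_const_div_intCast_atBot (c : ℝ) :
    Tendsto (fun n : ℤ => c / (n : ℝ)) atBot (𝓝 0) := by
  have h : Tendsto (fun n : ℤ => (n : ℝ)) atBot atBot := tendsto_intCast_atBot_iff.2 tendsto_id
  exact tendsto_const_nhds.div_atBot h

theorem HasRotationNumber.unique {θ : ℤ → ℝ} {ρ ρ' : ℝ} (h : HasRotationNumber θ ρ)
    (h' : HasRotationNumber θ ρ') : ρ = ρ' :=
  tendsto_nhds_unique h.1 h'.1

theorem HasRotationNumber.tendsto_nat {θ : ℤ → ℝ} {ρ : ℝ} (h : HasRotationNumber θ ρ) :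
    Tendsto (fun n : ℕ => θ n / (n : ℝ)) atTop (𝓝 ρ) := by
  simpa [Function.comp_def] using h.1.comp tendsto_natCast_atTop_atTop

theorem HasRotationNumber.nonneg {θ : ℤ → ℝ} (hθ : Monotone θ) {ρ : ℝ}
    (h : HasRotationNumber θ ρ) : 0 ≤ ρ := by
  refine le_of_tendsto_of_tendsto (tendsto_const_div_intCast_atTop (θ 0)) h.1 ?_
  filter_upwards [eventually_ge_atTop 0] with n hn
  exact div_le_div_of_nonneg_right (hθ hn) (by exact_mod_cast hn)

theorem hasRotationNumber_zero_of_bounded {θ : ℤ → ℝ} {B : ℝ} (h : ∀ i j, θ j - θ i ≤ B) :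
    HasRotationNumber θ 0 := by
  have hb : ∀ n : ℤ, |θ n / (n : ℝ)| ≤ |(|θ 0| + B) / n| := fun n => by
    rw [abs_div, abs_div]
    refine div_le_div_of_nonneg_right ((abs_le.2 ⟨?_, ?_⟩).trans (le_abs_self _)) (abs_nonneg _)
    · have := h n 0; have := neg_abs_le (θ 0); linarith
    · have := h 0 n; have := le_abs_self (θ 0); linarith
  constructor
  · refine squeeze_zero_norm (fun n => (Real.norm_eq_abs _).trans_le (hb n)) ?_
    simpa using (tendsto_const_div_intCast_atTop (|θ 0| + B)).abs
  · refine squeeze_zero_norm (fun n => (Real.norm_eq_abs _).trans_le (hb n)) ?_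
    simpa using (tendsto_const_div_intCast_atBot (|θ 0| + B)).abs

theorem HasRotationNumber.le_div {θ : ℤ → ℝ} {ρ W : ℝ} {P : ℕ} (hP : 0 < P)
    (hW : ∀ i : ℤ, θ (i + P) ≤ θ i + W) (h : HasRotationNumber θ ρ) : ρ ≤ W / P := by
  have hk : ∀ k : ℕ, θ ((P * k : ℕ) : ℤ) ≤ θ 0 + k * W := by
    intro k
    induction k with
    | zero => simp
    | succ k ih =>
      have := hW ((P * k : ℕ) : ℤ)
      rw [Nat.mul_succ, Nat.cast_add (P * k) P]
      push_cast at this ih ⊢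
      linarith
  have hPk : Tendsto (fun k : ℕ => P * k) atTop atTop := tendsto_id.const_mul_atTop' hP
  have h1 := h.tendsto_nat.comp hPk
  have h2 : Tendsto (fun k : ℕ => θ 0 / ((P * k : ℕ) : ℝ) + W / P) atTop (𝓝 (0 + W / P)) :=
    (tendsto_const_nhds.div_atTop (tendsto_natCast_atTop_atTop.comp hPk)).add tendsto_const_nhds
  rw [zero_add] at h2
  refine le_of_tendsto_of_tendsto h1 h2 ?_
  filter_upwards [eventually_gt_atTop 0] with k hk0
  have hP' : (0 : ℝ) < P := by exact_mod_cast hP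
  have hk' : (0 : ℝ) < k := by exact_mod_cast hk0
  have e : θ 0 / ((P * k : ℕ) : ℝ) + W / P = (θ 0 + k * W) / ((P * k : ℕ) : ℝ) := by
    push_cast
    field_simp
  rw [e]
  exact div_le_div_of_nonneg_right (hk k) (by positivity)

theorem add_le_of_sparse_int {θ : ℤ → ℝ} {Q : ℕ} (hQ : ∀ t : ℤ, θ t + 1 ≤ θ (t + Q)) (t : ℤ)
    (k : ℕ) : θ t + k ≤ θ (t + (Q * k : ℕ)) := by
  induction k with
  | zero => simp
  | succ k ih =>
    have := hQ (t + (Q * k : ℕ))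
    rw [Nat.mul_succ, Nat.cast_add (Q * k) Q, ← add_assoc]
    push_cast at this ih ⊢
    linarith

theorem tendsto_atTop_of_sparse {θ : ℤ → ℝ} (hθ : Monotone θ) {Q : ℕ}
    (hQ : ∀ t : ℤ, θ t + 1 ≤ θ (t + Q)) : Tendsto θ atTop atTop := by
  refine tendsto_atTop_atTop_of_monotone hθ fun b => ?_
  obtain ⟨k, hk⟩ := exists_nat_ge (b - θ 0)
  have := add_le_of_sparse_int hQ 0 k
  exact ⟨_, by linarith⟩

theorem tendsto_atBot_of_sparse {θ : ℤ → ℝ} (hθ : Monotone θ) {Q : ℕ}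
    (hQ : ∀ t : ℤ, θ t + 1 ≤ θ (t + Q)) : Tendsto θ atBot atBot := by
  refine tendsto_atBot_atBot_of_monotone hθ fun b => ?_
  obtain ⟨k, hk⟩ := exists_nat_ge (θ 0 - b)
  refine ⟨-(Q * k : ℕ), ?_⟩
  have := add_le_of_sparse_int hQ (-(Q * k : ℕ)) k
  rw [neg_add_cancel] at this
  linarith

/-- A configuration with `d` atoms per unit length, asymptotically on all long pieces, has rotation
number `1 / d`. -/
theorem hasRotationNumber_of_density {θ : ℤ → ℝ} (htop : Tendsto θ atTop atTop)
    (hbot : Tendsto θ atBot atBot) {d : ℝ} (hd : 0 < d)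
    (h : ∀ ε : ℝ, 0 < ε → ∃ M₀ : ℝ, ∀ i j : ℤ, i ≤ j → M₀ ≤ θ j - θ i →
      |((j : ℝ) - i) / (θ j - θ i) - d| ≤ ε) : HasRotationNumber θ d⁻¹ := by
  have key : ∀ l : Filter ℤ, (∀ M : ℝ, ∀ᶠ n in l, (0 ≤ n ∧ M ≤ θ n - θ 0) ∨
      (n ≤ 0 ∧ M ≤ θ 0 - θ n)) → Tendsto (fun n : ℤ => θ 0 / (n : ℝ)) l (𝓝 0) →
      Tendsto (fun n : ℤ => θ n / (n : ℝ)) l (𝓝 d⁻¹) := by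
    intro l hl h0
    have h1 : Tendsto (fun n : ℤ => (n : ℝ) / (θ n - θ 0)) l (𝓝 d) := by
      rw [Metric.tendsto_nhds]
      intro ε hε
      obtain ⟨M₀, hM₀⟩ := h (ε / 2) (half_pos hε)
      filter_upwards [hl M₀] with n hn
      rw [Real.dist_eq]
      refine lt_of_le_of_lt ?_ (half_lt_self hε)
      rcases hn with ⟨hn, hM⟩ | ⟨hn, hM⟩
      · simpa using hM₀ 0 n hn hM
      · have := hM₀ n 0 hn hM
        rwa [Int.cast_zero, zero_sub, ← neg_sub (θ n), neg_div_neg_eq] at this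
    have h2 := (h1.inv₀ hd.ne').add h0
    rw [add_zero] at h2
    refine h2.congr fun n => ?_
    rw [inv_div, ← add_div, sub_add_cancel]
  constructor
  · refine key atTop (fun M => ?_) (tendsto_const_div_intCast_atTop _)
    filter_upwards [eventually_ge_atTop 0, htop.eventually_ge_atTop (M + θ 0)] with n h1 h2
    exact Or.inl ⟨h1, by linarith⟩
  · refine key atBot (fun M => ?_) (tendsto_const_div_intCast_atBot _)
    filter_upwards [eventually_le_atBot 0, hbot.eventually_le_atBot (θ 0 - M)] with n h1 h2
    exact Or.inr ⟨h1, by linarith⟩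

/-- Uniform closeness of the densities of long pieces passes to the limit density `ρ⁻¹`. -/
theorem HasRotationNumber.abs_sub_inv_le {θ : ℤ → ℝ} (htop : Tendsto θ atTop atTop) {ρ : ℝ}
    (hρ : 0 < ρ) (hrot : HasRotationNumber θ ρ) {ε M₀ : ℝ}
    (h : ∀ i j k l : ℤ, i ≤ j → k ≤ l → M₀ ≤ θ j - θ i → M₀ ≤ θ l - θ k →
        |((j : ℝ) - i) / (θ j - θ i) - ((l : ℝ) - k) / (θ l - θ k)| ≤ ε) {i j : ℤ} (hij : i ≤ j)
    (hM : M₀ ≤ θ j - θ i) : |((j : ℝ) - i) / (θ j - θ i) - ρ⁻¹| ≤ ε := by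
  have h1 : Tendsto (fun n : ℤ => ((n : ℝ) - (0 : ℤ)) / (θ n - θ 0)) atTop (𝓝 ρ⁻¹) := by
    have h2 := (hrot.1.sub (tendsto_const_div_intCast_atTop (θ 0))).inv₀ (by simpa using hρ.ne')
    rw [sub_zero] at h2
    refine h2.congr fun n => ?_
    rw [← sub_div, inv_div, Int.cast_zero, sub_zero]
  refine le_of_tendsto (tendsto_const_nhds.sub h1).abs ?_
  filter_upwards [eventually_ge_atTop 0, htop.eventually_ge_atTop (M₀ + θ 0)] with n hn1 hn2
  exact h i j 0 n hij hn1 hM (by linarith)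

/-- An unbounded minimal configuration has a positive rotation number. -/
theorem exists_pos_hasRotationNumber (hU : Differentiable ℝ U) (hU' : StrictMono (deriv U))
    (hV : Differentiable ℝ V) (hs : IsQuasicrystal s) (hVs : IsShortRangePotential s V)
    {θ : ℤ → ℝ} (hθ : θ ∈ minimalConfigurations U V) {Q : ℕ}
    (hQ : ∀ t : ℤ, θ t + 1 ≤ θ (t + Q)) : ∃ ρ : ℝ, 0 < ρ ∧ HasRotationNumber θ ρ := by
  have htop := tendsto_atTop_of_sparse hθ.1 hQ
  have hbot := tendsto_atBot_of_sparse hθ.1 hQ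
  have hC := fun (ε : ℝ) (hε : 0 < ε) => exists_density_of_mem hU hU' hV hs hVs hε Q
  obtain ⟨G, hG, hgap⟩ : ∃ G : ℝ, 0 < G ∧ ∀ i : ℤ, θ (i + (1 : ℕ)) ≤ θ i + G := by
    obtain ⟨G, hG, h⟩ := exists_le_add_of_mem hU hU' hV (hs.isUniformlyRecurrent hVs)
      (L := θ 2 - θ 0) (sub_nonneg.2 (hθ.1 (by norm_num)))
    exact ⟨G, hG, fun i => h θ hθ i 0 1 (by norm_num)⟩
  have hgapn : ∀ n : ℕ, θ n ≤ θ 0 + n * G := by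
    intro n
    induction n with
    | zero => simp
    | succ n ih =>
      have := hgap n
      push_cast at this ⊢
      linarith
  have htopn : Tendsto (fun n : ℕ => θ n) atTop atTop := htop.comp tendsto_natCast_atTop_atTop
  obtain ⟨d, hd⟩ : ∃ d, Tendsto (fun n : ℕ => (n : ℝ) / (θ n - θ 0)) atTop (𝓝 d) := by
    refine cauchySeq_tendsto_of_complete (Metric.cauchySeq_iff'.2 fun ε hε => ?_)
    obtain ⟨M₀, -, hM₀⟩ := hC (ε / 2) (half_pos hε)
    obtain ⟨n₀, hn₀⟩ := eventually_atTop.1 (htopn.eventually_ge_atTop (M₀ + θ 0))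
    refine ⟨n₀, fun n hn => ?_⟩
    rw [Real.dist_eq]
    refine lt_of_le_of_lt ?_ (half_lt_self hε)
    have := hM₀ θ hθ hQ 0 n 0 n₀ (by omega) (by omega) (by linarith [hn₀ n hn])
      (by linarith [hn₀ n₀ le_rfl])
    simpa using this
  have hd0 : 0 < d := by
    refine (inv_pos.2 hG).trans_le (ge_of_tendsto hd ?_)
    filter_upwards [eventually_gt_atTop 0, htopn.eventually_ge_atTop (1 + θ 0)] with n hn hn'
    rw [le_div_iff₀ (by linarith), inv_mul_le_iff₀ hG]
    linarith [hgapn n]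
  refine ⟨d⁻¹, inv_pos.2 hd0, hasRotationNumber_of_density htop hbot hd0 fun ε hε => ?_⟩
  obtain ⟨M₀, -, hM₀⟩ := hC ε hε
  refine ⟨M₀, fun i j hij hM => le_of_tendsto (tendsto_const_nhds.sub hd).abs ?_⟩
  filter_upwards [htopn.eventually_ge_atTop (M₀ + θ 0)] with n hn
  have := hM₀ θ hθ hQ i j 0 n hij (by omega) hM (by linarith)
  simpa using this

/-- There is `W` such that a minimal configuration in which some piece is longer than `W` has a
bounded local number of atoms everywhere. -/
theorem exists_sparse (hU : Differentiable ℝ U) (hU' : StrictMono (deriv U))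
    (hV : Differentiable ℝ V) (hrec : IsUniformlyRecurrent V) :
    ∃ W : ℝ, ∀ θ ∈ minimalConfigurations U V, ∀ (i : ℤ) (P : ℕ), W < θ (i + P) - θ i →
      ∀ t : ℤ, θ t + 1 ≤ θ (t + (P + 1 : ℕ)) := by
  obtain ⟨W, hW, h⟩ := exists_le_add_of_mem hU hU' hV hrec zero_le_one
  refine ⟨W, fun θ hθ i P hi t => ?_⟩
  by_contra hlt
  have := h θ hθ i t P (not_le.1 hlt).le
  linarith

theorem exists_piece_of_unbounded {θ : ℤ → ℝ} (hθ : Monotone θ)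
    (hb : ¬ ∃ B, ∀ i j, θ j - θ i ≤ B) {W : ℝ} (hW : 0 ≤ W) :
    ∃ (i : ℤ) (P : ℕ), W < θ (i + P) - θ i := by
  push Not at hb
  obtain ⟨i, j, hij⟩ := hb W
  have hlt : i < j := hθ.reflect_lt (by linarith)
  exact ⟨i, (j - i).toNat, by rwa [show i + (((j - i).toNat : ℕ) : ℤ) = j by omega]⟩

theorem exists_hasRotationNumber (hU : Differentiable ℝ U) (hU' : StrictMono (deriv U))
    (hV : Differentiable ℝ V) (hs : IsQuasicrystal s) (hVs : IsShortRangePotential s V)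
    {θ : ℤ → ℝ} (hθ : θ ∈ minimalConfigurations U V) : ∃ ρ : ℝ, HasRotationNumber θ ρ := by
  by_cases hb : ∃ B, ∀ i j, θ j - θ i ≤ B
  · obtain ⟨B, hB⟩ := hb
    exact ⟨0, hasRotationNumber_zero_of_bounded hB⟩
  · obtain ⟨W, hW⟩ := exists_sparse hU hU' hV (hs.isUniformlyRecurrent hVs)
    obtain ⟨i, P, hiP⟩ := exists_piece_of_unbounded hθ.1 hb (le_max_right W 0)
    obtain ⟨ρ, -, hρ⟩ := exists_pos_hasRotationNumber hU hU' hV hs hVs hθ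
      (hW θ hθ i P ((le_max_left W 0).trans_lt hiP))
    exact ⟨ρ, hρ⟩

theorem continuous_rotationNumber (hU : Differentiable ℝ U) (hU' : StrictMono (deriv U))
    (hV : Differentiable ℝ V) (hs : IsQuasicrystal s) (hVs : IsShortRangePotential s V)
    {rot : minimalConfigurations U V → ℝ}
    (hrot : ∀ θ : minimalConfigurations U V, HasRotationNumber (θ : ℤ → ℝ) (rot θ)) :
    Continuous rot := by
  have heval : ∀ n : ℤ, Continuous fun χ : minimalConfigurations U V => (χ : ℤ → ℝ) n := fun n =>
    (continuous_apply n).comp continuous_subtype_val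
  have hdiff : ∀ a b : ℤ, Continuous fun χ : minimalConfigurations U V =>
      (χ : ℤ → ℝ) b - (χ : ℤ → ℝ) a := fun a b => (heval b).sub (heval a)
  have hrec := hs.isUniformlyRecurrent hVs
  refine continuous_iff_continuousAt.2 fun θ => ?_
  by_cases hb : ∃ B, ∀ i j, (θ : ℤ → ℝ) j - (θ : ℤ → ℝ) i ≤ B
  · -- many atoms in a short interval force a small rotation number
    obtain ⟨B, hB⟩ := hb
    have h0 : rot θ = 0 := (hrot θ).unique (hasRotationNumber_zero_of_bounded hB)
    have hB0 : 0 ≤ B := by simpa using hB 0 0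
    rw [ContinuousAt, h0, Metric.tendsto_nhds]
    intro ε hε
    obtain ⟨W, hW, h⟩ := exists_le_add_of_mem hU hU' hV hrec (show 0 ≤ B + 1 by linarith)
    obtain ⟨P, hP⟩ := exists_nat_gt (W / ε)
    have hP0 : (0 : ℝ) < P := lt_of_le_of_lt (by positivity) hP
    have hev := ((hdiff 0 (P + 1 : ℕ)).tendsto θ).eventually_lt_const
      (show _ < B + 1 by linarith [hB 0 (P + 1 : ℕ)])
    filter_upwards [hev] with χ hχ
    have h1 := (hrot χ).le_div (by exact_mod_cast hP0)
      fun i => h χ χ.2 i 0 P (by rw [zero_add]; linarith)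
    have h2 := (hrot χ).nonneg χ.2.1
    rw [Real.dist_eq, sub_zero, abs_of_nonneg h2]
    refine h1.trans_lt ?_
    rw [div_lt_iff₀ hP0]
    rwa [div_lt_iff₀ hε, mul_comm] at hP
  · obtain ⟨W, hW⟩ := exists_sparse hU hU' hV hrec
    obtain ⟨i, P, hiP⟩ := exists_piece_of_unbounded θ.2.1 hb (le_max_right W 0)
    have hiP := (le_max_left W 0).trans_lt hiP
    have hpos : ∀ χ : minimalConfigurations U V, W < (χ : ℤ → ℝ) (i + P) - (χ : ℤ → ℝ) i →
        0 < rot χ := fun χ hχ => by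
      obtain ⟨ρ, hρ, hχρ⟩ := exists_pos_hasRotationNumber hU hU' hV hs hVs χ.2 (hW χ χ.2 i P hχ)
      rwa [(hrot χ).unique hχρ]
    have hev := ((hdiff i (i + P)).tendsto θ).eventually_const_lt hiP
    have hinv : Tendsto (fun χ => (rot χ)⁻¹) (𝓝 θ) (𝓝 (rot θ)⁻¹) := by
      rw [Metric.tendsto_nhds]
      intro ε hε
      obtain ⟨M₀, hM₀, h⟩ := exists_density_of_mem hU hU' hV hs hVs
        (show 0 < ε / 4 by linarith) (P + 1)
      have hclose : ∀ χ : minimalConfigurations U V,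
          W < (χ : ℤ → ℝ) (i + P) - (χ : ℤ → ℝ) i → ∀ n : ℤ, 0 ≤ n →
          M₀ ≤ (χ : ℤ → ℝ) n - (χ : ℤ → ℝ) 0 →
          |((n : ℝ) - (0 : ℤ)) / ((χ : ℤ → ℝ) n - (χ : ℤ → ℝ) 0) - (rot χ)⁻¹| ≤ ε / 4 :=
        fun χ hχ n hn hM => (hrot χ).abs_sub_inv_le
          (tendsto_atTop_of_sparse χ.2.1 (hW χ χ.2 i P hχ)) (hpos χ hχ)
          (h χ χ.2 (hW χ χ.2 i P hχ)) hn hM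
      obtain ⟨n, hn, hnM⟩ := ((eventually_ge_atTop 0).and
        ((tendsto_atTop_of_sparse θ.2.1 (hW θ θ.2 i P hiP)).eventually_gt_atTop
          (M₀ + (θ : ℤ → ℝ) 0))).exists
      have hnM' : M₀ < (θ : ℤ → ℝ) n - (θ : ℤ → ℝ) 0 := by linarith
      have hev1 := ((hdiff 0 n).tendsto θ).eventually_const_lt hnM'
      have hcont : Tendsto (fun χ : minimalConfigurations U V =>
          ((n : ℝ) - (0 : ℤ)) / ((χ : ℤ → ℝ) n - (χ : ℤ → ℝ) 0)) (𝓝 θ)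
          (𝓝 (((n : ℝ) - (0 : ℤ)) / ((θ : ℤ → ℝ) n - (θ : ℤ → ℝ) 0))) :=
        tendsto_const_nhds.div ((hdiff 0 n).tendsto θ) (by linarith)
      have hev2 := Metric.tendsto_nhds.1 hcont (ε / 4) (by linarith)
      filter_upwards [hev, hev1, hev2] with χ h1 h2 h3
      have c1 := abs_le.1 (hclose χ h1 n hn h2.le)
      have c2 := abs_le.1 (hclose θ hiP n hn hnM'.le)
      rw [Real.dist_eq] at h3 ⊢
      have c3 := abs_lt.1 h3
      rw [abs_lt]
      constructor <;> linarith [c1.1, c1.2, c2.1, c2.2, c3.1, c3.2]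
    have := hinv.inv₀ (inv_ne_zero (hpos θ hiP).ne')
    rw [ContinuousAt]
    simpa only [inv_inv] using this

/-! ### Minimal configurations with a given rotation number -/

theorem continuous_pathEnergy (hU : Continuous U) (hV : Continuous V) (p : ℕ) :
    Continuous fun f : ℕ → ℝ => pathEnergy U V f p := by
  unfold pathEnergy
  fun_prop

theorem exists_isMinimalPath (hU : Continuous U) (hV : Continuous V) {N : ℕ} (hN : 0 < N) {a b : ℝ}
    (hab : a ≤ b) : ∃ f : ℕ → ℝ, IsMinimalPath U V f N ∧ f 0 = a ∧ f N = b := by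
  obtain ⟨C, hC⟩ : ∃ C : Set (ℕ → ℝ), C = Set.pi Set.univ (fun _ => Set.Icc a b) ∩
      ((⋂ t ∈ Finset.range N, {f | f t ≤ f (t + 1)}) ∩ ({f | f 0 = a} ∩ {f | f N = b})) := ⟨_, rfl⟩
  have hmem : ∀ g : ℕ → ℝ, (∀ t < N, g t ≤ g (t + 1)) → g 0 = a → g N = b →
      ∃ g' ∈ C, ∀ t ≤ N, g' t = g t := by
    intro g hg h0 hgN
    refine ⟨fun t => g (min t N), ?_, fun t ht => by simp only [min_eq_left ht]⟩
    rw [hC]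
    refine ⟨fun t _ => ⟨?_, ?_⟩, ?_, by simpa using h0, by simpa using hgN⟩
    · rw [← h0]; exact le_of_steps hg (Nat.zero_le _) (min_le_right _ _)
    · rw [← hgN]; exact le_of_steps hg (min_le_right _ _) le_rfl
    · simp only [Set.mem_iInter]
      exact fun t _ => le_of_steps hg (by omega) (min_le_right _ _)
  have hcomp : IsCompact C := by
    rw [hC]
    refine (isCompact_univ_pi fun _ => isCompact_Icc).inter_right (IsClosed.inter ?_
      ((isClosed_eq (by fun_prop) (by fun_prop)).inter (isClosed_eq (by fun_prop) (by fun_prop))))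
    exact isClosed_biInter fun t _ => isClosed_le (by fun_prop) (by fun_prop)
  have hne : C.Nonempty := by
    obtain ⟨g, hg, -⟩ := hmem (fun t => if t = 0 then a else b)
      (fun t _ => by simp only [Nat.succ_ne_zero, if_false]; split_ifs <;> linarith) (by simp)
      (by simp [hN.ne'])
    exact ⟨g, hg⟩
  obtain ⟨f, hf, hmin⟩ := hcomp.exists_isMinOn hne (continuous_pathEnergy hU hV N).continuousOn
  have hf' := hf
  rw [hC] at hf'
  obtain ⟨-, h1, h2, h3⟩ := hf'
  simp only [Set.mem_iInter, Finset.mem_range] at h1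
  refine ⟨f, ⟨h1, fun g hg h0 hgN => ?_⟩, h2, h3⟩
  obtain ⟨g', hg', hgg⟩ := hmem g hg (h0.trans h2) (hgN.trans h3)
  exact (hmin hg').trans_eq (pathEnergy_congr hgg)

/-- A pointwise limit of minimal paths is minimal. A competitor of the limit is turned into
competitors of the approximating paths by truncation at their endpoints. -/
theorem IsMinimalPath.of_tendsto (hU : Continuous U) (hV : Continuous V) {ι : Type*} {l : Filter ι}
    [l.NeBot] {h : ι → ℕ → ℝ} {f : ℕ → ℝ} (hlim : ∀ t, Tendsto (fun n => h n t) l (𝓝 (f t))) {p : ℕ}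
    (hmin : ∀ᶠ n in l, IsMinimalPath U V (h n) p) : IsMinimalPath U V f p := by
  have hsteps : ∀ t < p, f t ≤ f (t + 1) := fun t ht =>
    le_of_tendsto_of_tendsto (hlim t) (hlim (t + 1)) (hmin.mono fun n hn => hn.1 t ht)
  refine ⟨hsteps, fun g hg h0 hp => ?_⟩
  rcases Nat.eq_zero_or_pos p with rfl | hp0
  · simp [pathEnergy]
  set G : ι → ℕ → ℝ := fun n t => if t = 0 then h n 0 else if t = p then h n p else
    max (h n 0) (min (h n p) (g t)) with hG
  have hGlim : ∀ t ≤ p, Tendsto (fun n => G n t) l (𝓝 (g t)) := by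
    intro t ht
    by_cases ht0 : t = 0
    · subst ht0
      simpa [hG, h0] using hlim 0
    by_cases htp : t = p
    · subst htp
      simpa [hG, hp, ht0] using hlim t
    · simp only [hG, ht0, htp, if_false]
      have h1 : f 0 ≤ g t := h0 ▸ le_of_steps hg (Nat.zero_le t) ht
      have h2 : g t ≤ f p := hp ▸ le_of_steps hg ht le_rfl
      have := (hlim 0).max ((hlim p).min (tendsto_const_nhds (x := g t)))
      rwa [min_eq_right h2, max_eq_right h1] at this
  have henergy : ∀ (F : ι → ℕ → ℝ) (φ : ℕ → ℝ), (∀ t ≤ p, Tendsto (fun n => F n t) l (𝓝 (φ t))) →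
      Tendsto (fun n => pathEnergy U V (F n) p) l (𝓝 (pathEnergy U V φ p)) := by
    intro F φ hF
    refine tendsto_finsetSum _ fun t ht => ?_
    have htp := Finset.mem_range.1 ht
    exact ((hU.tendsto _).comp ((hF t htp.le).sub (hF (t + 1) htp))).add
      ((hV.tendsto _).comp (hF t htp.le))
  refine le_of_tendsto_of_tendsto (henergy h f fun t _ => hlim t) (henergy G g hGlim) ?_
  filter_upwards [hmin] with n hn
  refine hn.2 _ (fun t ht => ?_) (by simp [hG]) (by simp [hG, hp0.ne'])
  have h0p : h n 0 ≤ h n p := le_of_steps hn.1 (Nat.zero_le _) le_rfl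
  have hgt := hg t ht
  by_cases ht0 : t = 0 <;> by_cases htp : t + 1 = p
  · subst ht0 htp
    simpa [hG] using h0p
  · subst ht0
    simp [hG, show ¬ 1 = p by simpa using htp]
  · subst htp
    simp [hG, ht0, h0p]
  · simp only [hG, ht0, htp, ht.ne, if_false, Nat.succ_ne_zero]
    exact max_le_max le_rfl (min_le_min le_rfl hgt)

theorem const_mem_minimalConfigurations (c : ℝ) : (fun _ => c) ∈ minimalConfigurations U V := by
  refine ⟨monotone_const, fun i p θ' hθ' h0 hp => ?_⟩
  rw [segmentEnergy_eq_pathEnergy, segmentEnergy_eq_pathEnergy]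
  refine (pathEnergy_congr fun t ht => ?_).le
  have h1 := hθ' (show i ≤ i + t by omega)
  have h2 := hθ' (show i + t ≤ i + p by omega)
  linarith

theorem add_mul_le_of_forall {f : ℕ → ℝ} {P n : ℕ} {c : ℝ}
    (h : ∀ i, i + P ≤ P * n → f i + c ≤ f (i + P)) : f 0 + n * c ≤ f (P * n) := by
  have : ∀ k ≤ n, f 0 + k * c ≤ f (P * k) := by
    intro k
    induction k with
    | zero => simp
    | succ k ih =>
      intro hk
      have h1 := ih (by omega)
      have h2 := h (P * k) (by rw [← Nat.mul_succ]; exact Nat.mul_le_mul_left _ hk)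
      rw [Nat.mul_succ]
      push_cast
      linarith
  exact this n le_rfl

/-- Minimal configurations of rotation number `ρ` are limits of long minimal paths of mean step `ρ`,
reindexed so that the atom of index `0` stays close to the origin. These paths have uniformly bounded
steps and, locally, uniformly bounded numbers of atoms, because they do so on average. -/
theorem exists_mem_hasRotationNumber (hU : Differentiable ℝ U) (hU' : StrictMono (deriv U))
    (hV : Differentiable ℝ V) (hs : IsQuasicrystal s) (hVs : IsShortRangePotential s V) {ρ : ℝ}
    (hρ : 0 < ρ) : ∃ θ ∈ minimalConfigurations U V, HasRotationNumber θ ρ := by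
  have hrec := hs.isUniformlyRecurrent hVs
  obtain ⟨W, hW, hW'⟩ := hrec.exists_le_add hU hU' hV zero_le_one
  obtain ⟨G, hG, hG'⟩ := hrec.exists_le_add hU hU' hV (show 0 ≤ 2 * ρ + 1 by linarith)
  obtain ⟨P, hP⟩ := exists_nat_gt (W / ρ)
  rw [div_lt_iff₀ hρ] at hP
  have hP0 : (0 : ℝ) < P := by
    by_contra h
    have := mul_nonpos_of_nonpos_of_nonneg (not_lt.1 h) hρ.le
    linarith
  have hP0' : 0 < P := by exact_mod_cast hP0
  -- the minimal paths from `-n P ρ` to `n P ρ` with `2 n P` steps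
  have hpaths : ∀ n : ℕ, ∃ f : ℕ → ℝ, 0 < n → IsMinimalPath U V f (P * (2 * n)) ∧
      f 0 = -(n * P * ρ) ∧ f (P * (2 * n)) = n * P * ρ := by
    intro n
    rcases Nat.eq_zero_or_pos n with rfl | hn
    · exact ⟨0, fun h => absurd h (lt_irrefl _)⟩
    · have hpos : (0 : ℝ) ≤ n * P * ρ := by positivity
      obtain ⟨f, hf⟩ := exists_isMinimalPath hU.continuous hV.continuous
        (show 0 < P * (2 * n) by positivity) (show -(n * P * ρ) ≤ n * P * ρ by linarith)
      exact ⟨f, fun _ => hf⟩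
  choose f hf using hpaths
  have hsparse : ∀ n, 0 < n → ∀ t, t + (P + 1) ≤ P * (2 * n) → f n t + 1 ≤ f n (t + (P + 1)) := by
    intro n hn t ht
    obtain ⟨hmin, h0, h1⟩ := hf n hn
    by_contra hcon
    have hle : ∀ i, i + P ≤ P * (2 * n) → (fun i => -f n i) i + (-W) ≤ (fun i => -f n i) (i + P) :=
      fun i hi => by
        have := hW' _ _ hmin i t P ht (not_le.1 hcon).le hi
        simp only
        linarith
    have := add_mul_le_of_forall hle
    simp only [h0, h1] at this
    push_cast at this
    have hn' : (0 : ℝ) < n := by exact_mod_cast hn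
    have := mul_lt_mul_of_pos_left hP hn'
    linarith
  have hgap : ∀ n, 0 < n → ∀ t < P * (2 * n), f n (t + 1) ≤ f n t + G := by
    intro n hn t ht
    obtain ⟨hmin, h0, h1⟩ := hf n hn
    obtain ⟨j, hj, hjL⟩ : ∃ j, j + (1 + 1) ≤ P * (2 * n) ∧ f n (j + (1 + 1)) ≤ f n j + (2 * ρ + 1) := by
      by_contra hcon
      push Not at hcon
      have := add_mul_le_of_forall (f := f n) (P := 2) (n := P * n) (c := 2 * ρ + 1)
        fun i hi => (hcon i (by rwa [show P * (2 * n) = 2 * (P * n) by ring])).le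
      rw [show 2 * (P * n) = P * (2 * n) by ring, h0, h1] at this
      push_cast at this
      have hn' : (0 : ℝ) < n := by exact_mod_cast hn
      have : (0 : ℝ) < P * n := by positivity
      linarith
    exact hG' _ _ hmin t j 1 hj hjL ht
  -- the index of an atom close to the origin
  have hcenter : ∀ n, ∃ t, 0 < n → t ≤ P * (2 * n) ∧ |f n t| ≤ G ∧ n * P * ρ ≤ (t + 1) * G ∧
      n * P * ρ ≤ ((P * (2 * n) - t : ℕ) : ℝ) * G := by
    intro n
    rcases Nat.eq_zero_or_pos n with rfl | hn
    · exact ⟨0, fun h => absurd h (lt_irrefl _)⟩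
    obtain ⟨hmin, h0, h1⟩ := hf n hn
    have hn' : (0 : ℝ) < n := by exact_mod_cast hn
    have hpos : (0 : ℝ) < n * P * ρ := by positivity
    have hgap' := hgap n hn
    have hsteps : ∀ k t, t + k ≤ P * (2 * n) → f n (t + k) ≤ f n t + k * G := by
      intro k t
      induction k with
      | zero => simp
      | succ k ih =>
        intro hk
        have h2 := ih (by omega)
        have h3 := hgap' (t + k) (by omega)
        rw [← add_assoc]
        push_cast
        linarith
    classical
    have hex : ∃ t, t ≤ P * (2 * n) ∧ 0 < f n t := ⟨_, le_rfl, by rw [h1]; exact hpos⟩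
    obtain ⟨t, ht⟩ : ∃ t, Nat.find hex = t + 1 := by
      refine Nat.exists_eq_succ_of_ne_zero fun h => ?_
      have := (Nat.find_spec hex).2
      rw [h, h0] at this
      linarith
    obtain ⟨ht1, ht2⟩ := Nat.find_spec hex
    rw [ht] at ht1 ht2
    have ht3 : f n t ≤ 0 := by
      by_contra h
      exact Nat.find_min hex (m := t) (by omega) ⟨by omega, not_le.1 h⟩
    have ht4 := hgap' t (by omega)
    refine ⟨t, fun _ => ⟨by omega, abs_le.2 ⟨by linarith, by linarith⟩, ?_, ?_⟩⟩
    · have := hsteps (t + 1) 0 (by omega)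
      rw [zero_add] at this
      push_cast at this
      linarith
    · have := hsteps (P * (2 * n) - t) t (by omega)
      rw [show t + (P * (2 * n) - t) = P * (2 * n) by omega] at this
      linarith
  choose c hc using hcenter
  set χ : ℕ → ℤ → ℝ := fun n m => f n (min (m + c n).toNat (P * (2 * n))) with hχ
  have hχmono : ∀ n, 0 < n → Monotone (χ n) := fun n hn a b hab =>
    le_of_steps (hf n hn).1.1 (by omega) (min_le_right _ _)
  have hχgap : ∀ n, 0 < n → ∀ m, χ n (m + 1) ≤ χ n m + G := by
    intro n hn m
    simp only [hχ]
    rcases (show min (m + 1 + c n).toNat (P * (2 * n)) = min (m + c n).toNat (P * (2 * n)) ∨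
      (min (m + 1 + c n).toNat (P * (2 * n)) = min (m + c n).toNat (P * (2 * n)) + 1 ∧
        min (m + c n).toNat (P * (2 * n)) < P * (2 * n)) by omega) with h | ⟨h, h'⟩
    · rw [h]; linarith
    · rw [h]; exact hgap n hn _ h'
  have hχbound : ∀ n, 0 < n → ∀ m, |χ n m| ≤ (m.natAbs + 1) * G := by
    intro n hn m
    have h0 : |χ n 0| ≤ G := by
      obtain ⟨h1, h2, -⟩ := hc n hn
      simpa [hχ, h1] using h2
    have hup : ∀ k : ℕ, χ n k ≤ χ n 0 + k * G ∧ χ n 0 - k * G ≤ χ n (-k) := by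
      intro k
      induction k with
      | zero => simp
      | succ k ih =>
        have h1 := hχgap n hn k
        have h2 := hχgap n hn (-(k : ℤ) - 1)
        rw [sub_add_cancel] at h2
        push_cast
        rw [show -((k : ℤ) + 1) = -(k : ℤ) - 1 by ring]
        constructor <;> linarith [ih.1, ih.2]
    have h0 := abs_le.1 h0
    rw [abs_le]
    rcases le_total 0 m with hm | hm
    · have h1 := (hup m.natAbs).1
      rw [show ((m.natAbs : ℕ) : ℤ) = m by omega] at h1
      have h2 := hχmono n hn hm
      have h3 : (0 : ℝ) ≤ m.natAbs * G := by positivity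
      constructor <;> linarith [h0.1, h0.2]
    · have h1 := (hup m.natAbs).2
      rw [show -((m.natAbs : ℕ) : ℤ) = m by omega] at h1
      have h2 := hχmono n hn hm
      have h3 : (0 : ℝ) ≤ m.natAbs * G := by positivity
      constructor <;> linarith [h0.1, h0.2]
  -- on every fixed range of indices, `χ n` is eventually a reindexed piece of `f n`
  have hχeq : ∀ a : ℤ, ∀ᶠ n in atTop, 0 < n ∧ 0 ≤ a + c n ∧ a + c n ≤ (P * (2 * n) : ℕ) := by
    intro a
    have hlarge : ∀ b : ℝ, ∀ᶠ n : ℕ in atTop, b ≤ n * P * ρ := fun b => by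
      have : Tendsto (fun n : ℕ => (n : ℝ) * P * ρ) atTop atTop :=
        (tendsto_natCast_atTop_atTop.atTop_mul_const hP0).atTop_mul_const hρ
      exact this.eventually_ge_atTop b
    filter_upwards [eventually_gt_atTop 0, hlarge ((|(a : ℝ)| + 1) * G)] with n hn hn'
    obtain ⟨h1, -, h2, h3⟩ := hc n hn
    have h4 : |(a : ℝ)| + 1 ≤ c n + 1 := le_of_mul_le_mul_right (hn'.trans h2) hG
    have h5 : |(a : ℝ)| + 1 ≤ ((P * (2 * n) - c n : ℕ) : ℝ) :=
      le_of_mul_le_mul_right (hn'.trans h3) hG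
    have h6 : |a| ≤ c n := by
      have : |(a : ℝ)| ≤ c n := by linarith
      exact_mod_cast this
    have h7 : |a| + 1 ≤ ((P * (2 * n) - c n : ℕ) : ℤ) := by exact_mod_cast h5
    have h8 := abs_le.1 h6
    have h9 := le_abs_self a
    exact ⟨hn, by omega, by omega⟩
  have hχval : ∀ n (m : ℤ), 0 ≤ m + c n → m + c n ≤ (P * (2 * n) : ℕ) →
      χ n m = f n (m + c n).toNat := fun n m h1 h2 => by
    simp only [hχ]
    rw [min_eq_left (by omega)]
  -- a limit along an ultrafilter
  obtain ⟨l, hl⟩ : ∃ l : Ultrafilter ℕ, (l : Filter ℕ) ≤ atTop := Ultrafilter.exists_le atTop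
  have hlim : ∀ m : ℤ, ∃ x : ℝ, Tendsto (fun n => χ n m) l (𝓝 x) := by
    intro m
    have hmem : ((l.map fun n => χ n m : Ultrafilter ℝ) : Filter ℝ) ≤
        𝓟 (Set.Icc (-((m.natAbs + 1) * G)) ((m.natAbs + 1) * G)) := by
      rw [le_principal_iff]
      refine hl ?_
      filter_upwards [eventually_gt_atTop 0] with n hn
      exact abs_le.1 (hχbound n hn m)
    obtain ⟨x, -, hx⟩ := isCompact_Icc.ultrafilter_le_nhds _ hmem
    exact ⟨x, hx⟩
  choose θ hθ using hlim
  have hev0 : ∀ᶠ n in (l : Filter ℕ), 0 < n := hl (eventually_gt_atTop 0)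
  have hθmono : Monotone θ := fun a b hab =>
    le_of_tendsto_of_tendsto (hθ a) (hθ b) (hev0.mono fun n hn => hχmono n hn hab)
  have hθmin : θ ∈ minimalConfigurations U V := by
    refine mem_minimalConfigurations hθmono fun i p => ?_
    refine IsMinimalPath.of_tendsto hU.continuous hV.continuous (l := (l : Filter ℕ))
      (h := fun n t => χ n (i + t)) (fun t => hθ _) ?_
    filter_upwards [hl (hχeq i), hl (hχeq (i + p))] with n ⟨hn, h1, h2⟩ ⟨_, h3, h4⟩
    have hsub := (hf n hn).1.sub (i := (i + c n).toNat) (p := p) (by omega)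
    have heq : ∀ t ≤ p, f n ((i + c n).toNat + t) = χ n (i + t) := fun t ht => by
      rw [hχval n (i + t) (by omega) (by omega)]
      congr 1
      omega
    refine ⟨fun t _ => hχmono n hn (by push_cast; omega), fun g hg h0 hp => ?_⟩
    rw [← pathEnergy_congr heq]
    exact hsub.2 g hg (h0.trans (heq 0 (Nat.zero_le _)).symm) (hp.trans (heq p le_rfl).symm)
  have hθsparse : ∀ t : ℤ, θ t + 1 ≤ θ (t + (P + 1 : ℕ)) := by
    intro t
    refine le_of_tendsto_of_tendsto ((hθ t).add_const 1) (hθ _) ?_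
    filter_upwards [hl (hχeq t), hl (hχeq (t + (P + 1 : ℕ)))] with n ⟨hn, h1, h2⟩ ⟨_, h3, h4⟩
    rw [hχval n t h1 h2, hχval n _ h3 h4]
    have := hsparse n hn (t + c n).toNat (by omega)
    rwa [show (t + c n).toNat + (P + 1) = (t + (P + 1 : ℕ) + c n).toNat by omega] at this
  refine ⟨θ, hθmin, ?_⟩
  rw [← inv_inv ρ]
  refine hasRotationNumber_of_density (tendsto_atTop_of_sparse hθmono hθsparse)
    (tendsto_atBot_of_sparse hθmono hθsparse) (inv_pos.2 hρ) fun ε hε => ?_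
  obtain ⟨M₀, hM₀, hdens⟩ := hs.exists_density hU hU' hV hVs (half_pos hε) (P + 1)
  refine ⟨M₀ + 1, fun i j hij hM => ?_⟩
  have hdiff := (hθ j).sub (hθ i)
  refine le_of_tendsto ((((tendsto_const_nhds (x := (j : ℝ) - i)).div hdiff
    (by linarith)).sub_const ρ⁻¹).abs) ?_
  have hlarge : ∀ᶠ n : ℕ in (l : Filter ℕ), M₀ ≤ n * P * ρ := by
    have : Tendsto (fun n : ℕ => (n : ℝ) * P * ρ) atTop atTop :=
      (tendsto_natCast_atTop_atTop.atTop_mul_const hP0).atTop_mul_const hρ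
    exact hl (this.eventually_ge_atTop M₀)
  filter_upwards [hl (hχeq i), hl (hχeq j), hlarge,
    hdiff.eventually_const_lt (show M₀ < θ j - θ i by linarith)] with n ⟨hn, h1, h2⟩ ⟨_, h3, h4⟩ h5 h6
  -- compare with the density of the whole path, which is `1 / ρ`
  obtain ⟨hmin, h7, h8⟩ := hf n hn
  obtain ⟨A, hA⟩ := hdens _ _ hmin (hsparse n hn)
  have hn' : (0 : ℝ) < n := by exact_mod_cast hn
  have hpos : (0 : ℝ) < n * P * ρ := by positivity
  have c1 := hA 0 (P * (2 * n)) (Nat.zero_le _) le_rfl (by rw [h7, h8]; linarith)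
  simp only [Pi.div_apply]
  rw [hχval n i h1 h2, hχval n j h3 h4] at h6 ⊢
  have c2 := hA (i + c n).toNat (j + c n).toNat (by omega) (by omega) h6.le
  have e1 : (((j + c n).toNat : ℕ) : ℝ) - ((i + c n).toNat : ℕ) = (j : ℝ) - i := by
    have : (((j + c n).toNat : ℕ) : ℤ) - ((i + c n).toNat : ℕ) = j - i := by omega
    exact_mod_cast congrArg (fun z : ℤ => (z : ℝ)) this
  have e2 : (((P * (2 * n) : ℕ) : ℝ) - (0 : ℕ)) / (f n (P * (2 * n)) - f n 0) = ρ⁻¹ := by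
    rw [h7, h8]
    push_cast
    field_simp
    ring
  rw [e1] at c2
  rw [e2] at c1
  have c1 := abs_le.1 c1
  have c2 := abs_le.1 c2
  rw [abs_le]
  constructor <;> linarith [c1.1, c1.2, c2.1, c2.2]

end FrenkelKontorova

theorem theorem1 (U V : ℝ → ℝ) (s : ℤ → ℝ)
    (hU : ContDiff ℝ 2 U) (hU_convex : ∀ x : ℝ, 0 < deriv (deriv U) x)
    (hU_top : Tendsto (fun x : ℝ => U x / |x|) atTop atTop)
    (hU_bot : Tendsto (fun x : ℝ => U x / |x|) atBot atTop)
    (hs : FrenkelKontorova.IsQuasicrystal s)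
    (hV : ContDiff ℝ 2 V) (hV_range : FrenkelKontorova.IsShortRangePotential s V) :
    (∀ θ ∈ FrenkelKontorova.minimalConfigurations U V,
      ∃ ρ : ℝ, FrenkelKontorova.HasRotationNumber θ ρ) ∧
    (∃ rot : FrenkelKontorova.minimalConfigurations U V → ℝ,
      (∀ θ : FrenkelKontorova.minimalConfigurations U V,
        FrenkelKontorova.HasRotationNumber (θ : ℤ → ℝ) (rot θ)) ∧ Continuous rot) ∧
    (∀ ρ : ℝ, 0 ≤ ρ → ∃ θ ∈ FrenkelKontorova.minimalConfigurations U V,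
      FrenkelKontorova.HasRotationNumber θ ρ) := by
  have hUd : Differentiable ℝ U := hU.differentiable (by norm_num)
  have hVd : Differentiable ℝ V := hV.differentiable (by norm_num)
  have hU' : StrictMono (deriv U) := strictMono_of_deriv_pos hU_convex
  have hex := fun θ (hθ : θ ∈ FrenkelKontorova.minimalConfigurations U V) =>
    FrenkelKontorova.exists_hasRotationNumber hUd hU' hVd hs hV_range hθ
  refine ⟨hex, ?_, fun ρ hρ => ?_⟩
  · choose rot hrot using fun θ : FrenkelKontorova.minimalConfigurations U V => hex θ θ.2
    exact ⟨rot, hrot,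
      FrenkelKontorova.continuous_rotationNumber hUd hU' hVd hs hV_range hrot⟩
  · rcases hρ.eq_or_lt with rfl | hρ
    · exact ⟨fun _ => 0, FrenkelKontorova.const_mem_minimalConfigurations 0,
        FrenkelKontorova.hasRotationNumber_zero_of_bounded (B := 0) fun _ _ => by simp⟩
    · exact FrenkelKontorova.exists_mem_hasRotationNumber hUd hU' hVd hs hV_range hρ
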